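/- **Setting.** A generator is a continuous non-increasing $\psi:[0,\infty]\to[0,1]$ with $\psi(0)=1$, $\psi(\infty)=\lim_{t\to\infty}\psi(t)=0$, strictly decreasing on $[0,\inf\{t:\psi(t)=0\}]$. A function $f$ is completely monotone (c.m.) on $(0,\infty)$ if it is smooth there and $(-1)^kf^{(k)}\ge 0$ for all $k\ge 0$; $\Psi_\infty$ is the set of generators that are c.m. on $(0,\infty)$. Call $(\psi_1,\psi_2)\in\Psi_\infty^2$ nestable if $(\psi_1^{-1}\circ\psi_2)'$ is c.m. on $(0,\infty)$. Consider the families $$\psi^{(C,\theta)}(t)=(1+t)^{-1/\theta},\quad \psi^{(12,\theta)}(t)=(1+t^{1/\theta})^{-1},\quad \psi^{(14,\theta)}(t)=(1+t^{1/\theta})^{-\theta},$$ $$\psi^{(19,\theta)}(t)=\theta/\ln(t+e^\theta),\quad \psi^{(20,\theta)}(t)=\ln(t+e)^{-1/\theta}$$ with parameter ranges $\Theta_C=\Theta_{19}=\Theta_{20}=(0,\infty)$ and $\Theta_{12}=\Theta_{14}=[1,\infty)$. Let $\mathcal F_{24}=\{C,12,14,19,20\}$, $\mathcal N_0=\{(a,\Theta_a):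 a\in\mathcal F_{24}\}$ and $$\mathcal N^2(C,\theta)=\{(C,(0,\theta])\},\qquad \mathcal N^2(12,\theta)=\{(C,(0,1]),(12,[1,\theta])\},\qquad \mathcal N^2(14,\theta)=\{(C,(0,1/\theta])\},$$ $$\mathcal N^2(19,\theta)=\{(C,(0,1]),(19,(0,\theta])\},\qquad \mathcal N^2(20,\theta)=\{(C,(0,\theta]),(20,(0,\theta])\}.$$ For finite sets $\mathcal N,\mathcal N'$ of pairs (family label, interval) put $\mathcal N\,\tilde\cap\,\mathcal N'=\{(a,r\cap r'):(a,r)\in\mathcal N,\ (a,r')\in\mathcal N'\}$. **The algorithm.** Inputs: data $(U_{mj})_{m\le n,\,j\le d}$ with $d\ge 2$; a $[0,\infty)$-aggregation function $g$ (that is, for every number of arguments $k\ge1$, a symmetric function $[0,\infty)^k\to[0,\infty)$ with $g(x,\dots,x)=x$); a goodness-of-fit statistic $S$, assigning a value in $[0,\infty)$ to two data columns and a bivariate copula. *Structure.* Let $\tau_{ij}$ be the sample Kendall's tau of the columns $i,j$. Start with the set $I=\{1,\dots,d\}$ of leaves. For $k=1,\dots,d-1$, choose $i<j$ in $I$ for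 which the average $\hat\tau_{d+k}$ of $\tau_{i'j'}$ over $i'\in{\downarrow}(i)$, $j'\in{\downarrow}(j)$ is maximal, where ${\downarrow}(v)$ is the set of leaves below $v$ (and $\{v\}$ if $v$ is a leaf); make $i,j$ the children of the new node (fork) $d+k$, and replace $i,j$ by $d+k$ in $I$. This gives a tree $(\hat V,\hat E)$ with $\hat V=\{1,\dots,2d-1\}$. *Generators.* Put $\mathcal N^1(v)=\mathcal N_0$ for the leaves $v$. For $k=1,\dots,d-1$, let $i<j$ be the children of $d+k$ and let $\mathcal N=\mathcal N^1(i)\,\tilde\cap\,\mathcal N^1(j)$; stop without a result if $\mathcal N=\emptyset$. For each $(a,r)\in\mathcal N$, let $\hat\theta_{(a,r)}=\max\{\min\{\tau_a^{-1}(\hat\tau_{d+k}),\beta\},\alpha\}$, where $\tau_a(\theta)=1-4\int_0^\infty t\,\big(\tfrac{\partial}{\partial t}\psi^{(a,\theta)}(t)\big)^2dt$ and $[\alpha,\beta]\subseteq r$ is $r$ with each endpoint that does not belong to $r$ replaced by a number of $r$ (the extreme one available to the computing system). If $\hat\tau_{d+k}\notin\tau_a(\Theta_a)$, then $\tau_a^{-1}(\hat\tau_{d+k})$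 stands for the lowest (when $\hat\tau_{d+k}$ is below this range) or highest (when above) available number of $\Theta_a$, in the same sense. Choose $(a^*,r^*)\in\mathcal N$ for which $g$, applied to the values of $S$ for the column pairs in ${\downarrow}(i)\times{\downarrow}(j)$ and the bivariate Archimedean copula $C_\psi(u_1,u_2)=\psi(\psi^{-1}(u_1)+\psi^{-1}(u_2))$ with $\psi=\psi^{(a,\hat\theta_{(a,r)})}$, is minimal, and set $\hat\theta^*=\hat\theta_{(a^*,r^*)}$. Put $\hat\lambda(d+k)=\psi^{(a^*,\hat\theta^*)}$ and $\mathcal N^1(d+k)=\mathcal N\,\tilde\cap\,\mathcal N^2(a^*,\hat\theta^*)$; stop without a result if $\mathcal N^1(d+k)=\emptyset$. After the last loop return $(\hat V,\hat E,\hat\lambda)$. **Theorem.** For all data $U$, all $g$ and all $S$, and for every choice made in case of ties and for the replaced endpoints, the algorithm does not stop prematurely: it returns a triplet $(\hat V,\hat E,\hat\lambda)$ in which $(\hat V,\hat E)$ is a tree rooted in $2d-1$ with leaves $1,\dots,d$ and forks $d+1,\dots,2d-1$, each fork having at least two children, $\hat\lambda$ maps the forks into $\Psi_\infty$, and the sufficient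 nesting condition holds: $(\hat\lambda(v),\hat\lambda(w))$ is nestable for every fork $v$ and every fork $w$ that is a child of $v$. -/

import Mathlib

open scoped ENNReal NNReal ContDiff

namespace HAC

noncomputable section

/-! ## Archimedean generators, complete monotonicity, nesting -/

/-- An Archimedean generator: a continuous, non-increasing `ψ : [0,∞] → [0,1]` with `ψ 0 = 1` and
`ψ ∞ = lim_{t → ∞} ψ t = 0`, strictly decreasing on `[0, inf {t | ψ t = 0}]`. -/
structure IsGenerator (ψ : ℝ≥0∞ → ℝ) : Prop where
  continuous : Continuous ψ
  antitone : Antitone ψ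
  mem_Icc : ∀ t, ψ t ∈ Set.Icc (0 : ℝ) 1
  map_zero : ψ 0 = 1
  map_top : ψ ⊤ = 0
  strictAntiOn : StrictAntiOn ψ (Set.Icc 0 (sInf {t | ψ t = 0}))

/-- Complete monotonicity of `f` on `(0,∞)`: smooth, with `(-1)^k f^{(k)} ≥ 0` for all `k ≥ 0`. -/
def IsCM (f : ℝ → ℝ) : Prop :=
  ContDiffOn ℝ ∞ f (Set.Ioi 0) ∧ ∀ (k : ℕ) (t : ℝ), 0 < t → 0 ≤ (-1 : ℝ) ^ k * iteratedDeriv k f t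

/-- The set of completely monotone generators. -/
def cmGenerators : Set (ℝ≥0∞ → ℝ) :=
  {ψ | IsGenerator ψ ∧ IsCM (fun t : ℝ => ψ (ENNReal.ofReal t))}

/-- `ψ⁻(s) = inf {t ∈ [0,∞] | ψ t = s}`, the ordinary inverse for a strictly decreasing `ψ`. -/
def genInv (ψ : ℝ≥0∞ → ℝ) (s : ℝ) : ℝ≥0∞ := sInf {t | ψ t = s}

/-- The bivariate Archimedean copula `C_ψ(u₁,u₂) = ψ(ψ⁻(u₁) + ψ⁻(u₂))`. -/
def archCopula (ψ : ℝ≥0∞ → ℝ) (u₁ u₂ : ℝ) : ℝ := ψ (genInv ψ u₁ + genInv ψ u₂)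

/-- `ψ₁⁻¹ ∘ ψ₂` as a real function (used on `(0,∞)`). -/
def nestingMap (ψ₁ ψ₂ : ℝ≥0∞ → ℝ) (t : ℝ) : ℝ := (genInv ψ₁ (ψ₂ (ENNReal.ofReal t))).toReal

/-- The nestable pairs (parent, child): both are completely monotone generators and
`(ψ₁⁻¹ ∘ ψ₂)'` exists on `(0,∞)` and is completely monotone. -/
def nestablePairs : Set ((ℝ≥0∞ → ℝ) × (ℝ≥0∞ → ℝ)) :=
  {p | p.1 ∈ cmGenerators ∧ p.2 ∈ cmGenerators ∧
    DifferentiableOn ℝ (nestingMap p.1 p.2) (Set.Ioi 0) ∧ IsCM (deriv (nestingMap p.1 p.2))}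

/-! ## The parametric families -/

/-- Labels of the families: Ali-Mikhail-Haq, Clayton, and Nelsen's numbers 12, 14, 19, 20. -/
inductive Family : Type
  | A | C | n12 | n14 | n19 | n20

/-- Finite values of the generators. -/
def genFormula : Family → ℝ → ℝ → ℝ
  | .A, θ, t => (1 - θ) / (Real.exp t - θ)
  | .C, θ, t => (1 + t) ^ (-1 / θ)
  | .n12, θ, t => (1 + t ^ (1 / θ))⁻¹
  | .n14, θ, t => (1 + t ^ (1 / θ)) ^ (-θ)
  | .n19, θ, t => θ / Real.log (t + Real.exp θ)
  | .n20, θ, t => Real.log (t + Real.exp 1) ^ (-1 / θ)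

open scoped Classical in
/-- The generator `ψ^{(a,θ)} : [0,∞] → [0,1]`. -/
def gen (a : Family) (θ : ℝ) (t : ℝ≥0∞) : ℝ := if t = ⊤ then 0 else genFormula a θ t.toReal

/-- Intervals of `[0,∞)` (open, half-open or closed, bounded or not, possibly empty). -/
abbrev ParamInterval : Type := {r : Set ℝ // r.OrdConnected ∧ r ⊆ Set.Ici 0}

/-- `[α, β]` for `α ≥ 0`. -/
def pIcc (α β : ℝ) (h : 0 ≤ α) : ParamInterval :=
  ⟨Set.Icc α β, Set.ordConnected_Icc, fun _ hx => h.trans hx.1⟩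

/-- `(0, β]`. -/
def pIoc (β : ℝ) : ParamInterval :=
  ⟨Set.Ioc 0 β, Set.ordConnected_Ioc, fun _ hx => hx.1.le⟩

/-- The parameter range `Θ_a`. -/
def paramRange : Family → ParamInterval
  | .A => ⟨Set.Ico 0 1, Set.ordConnected_Ico, fun _ hx => hx.1⟩
  | .C => ⟨Set.Ioi 0, Set.ordConnected_Ioi, fun x hx => (show (0 : ℝ) < x from hx).le⟩
  | .n12 => ⟨Set.Ici 1, Set.ordConnected_Ici, fun x hx => zero_le_one.trans (show (1 : ℝ) ≤ x from hx)⟩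
  | .n14 => ⟨Set.Ici 1, Set.ordConnected_Ici, fun x hx => zero_le_one.trans (show (1 : ℝ) ≤ x from hx)⟩
  | .n19 => ⟨Set.Ioi 0, Set.ordConnected_Ioi, fun x hx => (show (0 : ℝ) < x from hx).le⟩
  | .n20 => ⟨Set.Ioi 0, Set.ordConnected_Ioi, fun x hx => (show (0 : ℝ) < x from hx).le⟩

/-- Kendall's tau of the family `a` as a function of the parameter:
`τ_a(θ) = 1 - 4 ∫_0^∞ t (ψ'(t))² dt` with `ψ = ψ^{(a,θ)}`. -/
def familyTau (a : Family) (θ : ℝ) : ℝ :=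
  1 - 4 * ∫ t in Set.Ioi (0 : ℝ), t * (deriv (fun s : ℝ => gen a θ (ENNReal.ofReal s)) t) ^ 2

/-! ## The nesting semigroup -/

/-- Finite sets of pairs (family label, parameter interval). -/
abbrev NestSet : Type := Finset (Family × ParamInterval)

open scoped Classical in
/-- The operation `N₁ ∩̃ N₂ = {(a, r₁ ∩ r₂) | (a, r₁) ∈ N₁, (a, r₂) ∈ N₂}`. -/
def nestInter (N₁ N₂ : NestSet) : NestSet :=
  ((N₁ ×ˢ N₂).filter (fun p => p.1.1 = p.2.1)).image
    (fun p => (p.1.1, ⟨p.1.2.1 ∩ p.2.2.1, p.1.2.2.1.inter p.2.2.2.1,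
      fun _ hx => p.1.2.2.2 hx.1⟩))

open scoped Classical in
/-- `F₂₄ = {C, 12, 14, 19, 20}`. -/
def F24 : Finset Family := {.C, .n12, .n14, .n19, .n20}

open scoped Classical in
/-- `{(a, Θ_a) | a ∈ F}`, all generators of the families in `F`. -/
def fullNestSet (F : Finset Family) : NestSet := F.image (fun a => (a, paramRange a))

open scoped Classical in
/-- Admissible parents of a child `(a, θ)` with `a ∈ F₂₄`. -/
def parents24 : Family → ℝ → NestSet
  | .A, _ => ∅
  | .C, θ => {(.C, pIoc θ)}
  | .n12, θ => {(.C, pIoc 1), (.n12, pIcc 1 θ zero_le_one)}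
  | .n14, θ => {(.C, pIoc (1 / θ))}
  | .n19, θ => {(.C, pIoc 1), (.n19, pIoc θ)}
  | .n20, θ => {(.C, pIoc θ), (.n20, pIoc θ)}

/-! ## Rooted trees and the sufficient nesting condition

A rooted tree is given by its set of edges `(child, parent)`. -/

/-- `∧(v)`, the children of `v`. -/
def children (E : Finset (ℕ × ℕ)) (v : ℕ) : Finset ℕ := (E.filter (fun e => e.2 = v)).image Prod.fst

/-- A tree on the nodes `{1, …, d+k}` rooted in `d+k`, whose leaves are `{1, …, d}` and whose forks
`{d+1, …, d+k}` have at least two children each. -/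
structure IsHACTree (d k : ℕ) (V : Finset ℕ) (E : Finset (ℕ × ℕ)) : Prop where
  nodes : V = Finset.Icc 1 (d + k)
  edges : ∀ e ∈ E, e.1 ∈ V ∧ e.2 ∈ V
  root : ∀ v, (d + k, v) ∉ E
  parent : ∀ w ∈ V, w ≠ d + k → ∃! v, (w, v) ∈ E
  reaches_root : ∀ w ∈ V, Relation.ReflTransGen (fun w v => (w, v) ∈ E) w (d + k)
  leaf : ∀ v ∈ Finset.Icc 1 d, children E v = ∅
  fork : ∀ v ∈ Finset.Icc (d + 1) (d + k), 2 ≤ (children E v).card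

/-- A triplet `(V, E, λ)`; only the values of the labeling at the forks matter. -/
structure Triplet : Type where
  V : Finset ℕ
  E : Finset (ℕ × ℕ)
  lam : ℕ → ℝ≥0∞ → ℝ

/-- The sufficient nesting condition for a triplet `(V, E, λ)` with `d` leaves and `k` forks:
`(λ(v), λ(w))` is a nestable pair for every fork `v` and every fork `w` that is a child of `v`. -/
def SufficientNesting (d k : ℕ) (T : Triplet) : Prop :=
  ∀ v ∈ Finset.Icc (d + 1) (d + k), ∀ w ∈ children T.E v ∩ Finset.Icc (d + 1) (d + k),
    (T.lam v, T.lam w) ∈ nestablePairs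

/-! ## Structure estimation -/

/-- Sample version of Kendall's tau of two data columns,
`4 / (n (n - 1)) * #{concordant pairs k < l} - 1`. -/
def sampleTau {n : ℕ} (x y : Fin n → ℝ) : ℝ :=
  4 / ((n : ℝ) * ((n : ℝ) - 1)) *
    ((Finset.univ.filter (fun p : Fin n × Fin n =>
      p.1 < p.2 ∧ 0 < (x p.1 - x p.2) * (y p.1 - y p.2))).card : ℝ) - 1

/-- The sample Kendall correlation matrix of the data matrix `U` (`n` rows, `d` columns). -/
def sampleTauMatrix {n d : ℕ} (U : Fin n → Fin d → ℝ) (i j : Fin d) : ℝ :=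
  sampleTau (fun m => U m i) (fun m => U m j)

open scoped Classical in
/-- `↓(v)`, the data columns `j` (that is, leaves `j + 1`) that are `v` or descendants of `v`. -/
def leavesBelow (d : ℕ) (E : Finset (ℕ × ℕ)) (v : ℕ) : Finset (Fin d) :=
  Finset.univ.filter
    (fun j => Relation.ReflTransGen (fun w v => (w, v) ∈ E) ((j : ℕ) + 1) v)

/-- The average of `τ_{ij}` over `(i, j) ∈ ↓(v) × ↓(w)`. -/
def avgTau {d : ℕ} (τ : Fin d → Fin d → ℝ) (E : Finset (ℕ × ℕ)) (v w : ℕ) : ℝ :=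
  (∑ p ∈ leavesBelow d E v ×ˢ leavesBelow d E w, τ p.1 p.2) /
    ((leavesBelow d E v ×ˢ leavesBelow d E w).card : ℝ)

/-- State of the structure estimation: nodes still to be joined, edges, estimated taus of forks. -/
structure StructState : Type where
  I : Finset ℕ
  E : Finset (ℕ × ℕ)
  tau : ℕ → ℝ

open scoped Classical in
/-- The pairs `(i, j)`, `i < j`, `i, j ∈ I`, of maximal average tau. -/
def bestJoins {d : ℕ} (τ : Fin d → Fin d → ℝ) (s : StructState) : Finset (ℕ × ℕ) :=
  ((s.I ×ˢ s.I).filter (fun p => p.1 < p.2)).filter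
    (fun p => ∀ q ∈ (s.I ×ˢ s.I).filter (fun p => p.1 < p.2),
      avgTau τ s.E q.1 q.2 ≤ avgTau τ s.E p.1 p.2)

/-- The state after `k` loops of the structure estimation. `tie k S` is the element of the set `S`
of maximizers that is taken as the `argmax` in loop `k`. -/
def structIter {d : ℕ} (τ : Fin d → Fin d → ℝ) (tie : ℕ → Finset (ℕ × ℕ) → ℕ × ℕ) :
    ℕ → StructState
  | 0 => { I := Finset.Icc 1 d, E := ∅, tau := fun _ => 0 }
  | k + 1 =>
    let s := structIter τ tie k
    let p := tie (k + 1) (bestJoins τ s)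
    { I := (s.I ∪ {d + (k + 1)}) \ {p.1, p.2}
      E := s.E ∪ {(p.1, d + (k + 1)), (p.2, d + (k + 1))}
      tau := Function.update s.tau (d + (k + 1)) (avgTau τ s.E p.1 p.2) }

/-! ## Estimation of the generators -/

/-- `[α, β]` is a closed interval that replaces the interval `r` in the computations: endpoints that
belong to `r` are kept, and a missing endpoint (open or infinite) is replaced by some number of `r`
(the extreme one that the computing system allows). -/
def IsClosing (r : Set ℝ) (α β : ℝ) : Prop :=
  α ∈ r ∧ β ∈ r ∧ α ≤ β ∧ (∀ m, IsLeast r m → α = m) ∧ (∀ m, IsGreatest r m → β = m)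

/-- Every non-empty set of reals can be closed in this way. -/
theorem exists_isClosing (r : Set ℝ) (hr : r.Nonempty) : ∃ α β, IsClosing r α β := by
  obtain ⟨x, hx⟩ := hr
  have hα : ∃ α ∈ r, α ≤ x ∧ ∀ m, IsLeast r m → α = m := by
    by_cases h : ∃ m, IsLeast r m
    · obtain ⟨m, hm⟩ := h
      exact ⟨m, hm.1, hm.2 hx, fun m' hm' => hm.unique hm'⟩
    · exact ⟨x, hx, le_rfl, fun m hm => (h ⟨m, hm⟩).elim⟩
  have hβ : ∃ β ∈ r, x ≤ β ∧ ∀ m, IsGreatest r m → β = m := by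
    by_cases h : ∃ m, IsGreatest r m
    · obtain ⟨m, hm⟩ := h
      exact ⟨m, hm.1, hm.2 hx, fun m' hm' => hm.unique hm'⟩
    · exact ⟨x, hx, le_rfl, fun m hm => (h ⟨m, hm⟩).elim⟩
  obtain ⟨α, h1, h2, h3⟩ := hα
  obtain ⟨β, h4, h5, h6⟩ := hβ
  exact ⟨α, β, h1, h4, h2.trans h5, h3, h6⟩

/-- `trim(θ, r) = max (min θ β) α`, where `[α, β]` is the closed interval replacing `r`. -/
def trim (cl : ParamInterval → ℝ × ℝ) (θ : ℝ) (r : ParamInterval) : ℝ :=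
  max (min θ (cl r).2) (cl r).1

open scoped Classical in
/-- The inversion estimator `τ_a⁻¹(t)`. If `t` is not in `τ_a(Θ_a)`, then the lowest (if `t` is below
the range of `τ_a`) or the highest (if `t` is above it) allowed parameter is taken. -/
def tauInv (cl : ParamInterval → ℝ × ℝ) (a : Family) (t : ℝ) : ℝ :=
  if ∃ θ ∈ (paramRange a).1, familyTau a θ = t then
    Function.invFunOn (familyTau a) (paramRange a).1 t
  else if ∀ θ ∈ (paramRange a).1, t < familyTau a θ then (cl (paramRange a)).1
  else (cl (paramRange a)).2

/-- A `[0,∞)`-aggregation function (of any positive number of arguments). -/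
structure IsAggregation (g : (k : ℕ) → (Fin k → ℝ≥0) → ℝ≥0) : Prop where
  idem : ∀ k, 0 < k → ∀ x : ℝ≥0, g k (fun _ => x) = x
  exchangeable : ∀ k (σ : Equiv.Perm (Fin k)) (x : Fin k → ℝ≥0), g k (x ∘ σ) = g k x

/-- The aggregated statistic: `g` applied to the values `S((U_i, U_j), C_ψ)`, `(i, j) ∈ I × J`, listed
lexicographically. For one pair `(i, j)` this is the statistic itself, as `g` is idempotent. -/
def aggStat {n d : ℕ} (U : Fin n → Fin d → ℝ) (g : (k : ℕ) → (Fin k → ℝ≥0) → ℝ≥0)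
    (S : (Fin n → ℝ) → (Fin n → ℝ) → (ℝ → ℝ → ℝ) → ℝ≥0)
    (I J : Finset (Fin d)) (ψ : ℝ≥0∞ → ℝ) : ℝ≥0 :=
  g (I.card * J.card) (fun t =>
    S (fun m => U m (I.orderEmbOfFin rfl (finProdFinEquiv.symm t).1))
      (fun m => U m (J.orderEmbOfFin rfl (finProdFinEquiv.symm t).2)) (archCopula ψ))

/-- State of the estimation: admissible parents `N¹` and labeling `λ` of the nodes treated so far. -/
structure EstState : Type where
  parents : ℕ → NestSet
  lam : ℕ → ℝ≥0∞ → ℝ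

open scoped Classical in
/-- The elements of `N` of minimal cost. -/
def bestFits (N : NestSet) (cost : Family × ParamInterval → ℝ≥0) : NestSet :=
  N.filter (fun p => ∀ q ∈ N, cost p ≤ cost q)

open scoped Classical in
/-- One loop of the estimation, for the fork `v` with children `i < j`; `none` means that the
algorithm stops without a result. Here `t` is the estimated tau of the fork, `Nsq` the mapping giving
the admissible parents of a pair (family, parameter), `stat` the statistic of the generators for this
fork, and `tie` selects the `argmin` from the set of minimizers. -/
def estStep (Nsq : Family → ℝ → NestSet) (cl : ParamInterval → ℝ × ℝ)
    (tie : NestSet → Family × ParamInterval)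
    (stat : (ℝ≥0∞ → ℝ) → ℝ≥0) (t : ℝ) (v i j : ℕ) (s : EstState) : Option EstState :=
  let N := nestInter (s.parents i) (s.parents j)
  if N = ∅ then none
  else
    let θ : Family × ParamInterval → ℝ := fun p => trim cl (tauInv cl p.1 t) p.2
    let p := tie (bestFits N (fun p => stat (gen p.1 (θ p))))
    let N' := nestInter N (Nsq p.1 (θ p))
    if N' = ∅ then none
    else some
      { parents := Function.update s.parents v N'
        lam := Function.update s.lam v (gen p.1 (θ p)) }

/-- The state after `k` loops of the estimation, or `none` if the algorithm has stopped. -/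
def estIter {n d : ℕ} (U : Fin n → Fin d → ℝ) (N₀ : NestSet) (Nsq : Family → ℝ → NestSet)
    (g : (k : ℕ) → (Fin k → ℝ≥0) → ℝ≥0)
    (S : (Fin n → ℝ) → (Fin n → ℝ) → (ℝ → ℝ → ℝ) → ℝ≥0)
    (cl : ParamInterval → ℝ × ℝ) (tie : ℕ → NestSet → Family × ParamInterval)
    (str : StructState) : ℕ → Option EstState
  | 0 => some
      { parents := fun v => if v ∈ Finset.Icc 1 d then N₀ else ∅
        lam := fun _ _ => 0 }
  | k + 1 =>
    let v := d + (k + 1)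
    let i := sInf {w | w ∈ children str.E v}
    let j := sSup {w | w ∈ children str.E v}
    (estIter U N₀ Nsq g S cl tie str k).bind
      (estStep Nsq cl (tie (k + 1))
        (aggStat U g S (leavesBelow d str.E i) (leavesBelow d str.E j)) (str.tau v) v i j)

/-- The heterogeneous HAC estimation algorithm: estimate the structure by agglomerative clustering of
the sample Kendall matrix, then estimate the generators of the forks `d+1, …, 2d-1` in turn. The
value `none` means that the algorithm stops without a result. -/
def hacEstimate {n d : ℕ} (U : Fin n → Fin d → ℝ) (N₀ : NestSet) (Nsq : Family → ℝ → NestSet)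
    (g : (k : ℕ) → (Fin k → ℝ≥0) → ℝ≥0)
    (S : (Fin n → ℝ) → (Fin n → ℝ) → (ℝ → ℝ → ℝ) → ℝ≥0)
    (cl : ParamInterval → ℝ × ℝ)
    (tieJoin : ℕ → Finset (ℕ × ℕ) → ℕ × ℕ) (tieFit : ℕ → NestSet → Family × ParamInterval) :
    Option Triplet :=
  let str := structIter (sampleTauMatrix U) tieJoin (d - 1)
  (estIter U N₀ Nsq g S cl tieFit str (d - 1)).map
    (fun s => { V := Finset.Icc 1 (2 * d - 1), E := str.E, lam := s.lam })

end

end HAC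

/-!
The estimation keeps running because of an invariant of the sets `N¹(v)` (`IsAdmissible`): each of
them has a Clayton entry, and each of its entries is a non-empty initial segment of the parameter
range of its family. The full sets and all sets `parents24 a θ` with `θ ∈ Θ_a` have this property,
and it is inherited by `nestInter`, since two non-empty initial segments of an interval meet in one.
So the trimmed estimate `θ` lies in the chosen interval `r`. If the fork `w` is a child of the fork
`v`, then the entry chosen at `v` is contained in an entry of `parents24` at the generator of `w`, and
it remains to show that the pairs described by `parents24` are nestable
(`nestable_of_mem_parents24`).

Each generator is `u ^ (-c)` with `c > 0` and a Bernstein function `u` with `u 0 = 1` (`IsNegPow`), so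
it is completely monotone. For a Clayton parent, `ψ₁⁻¹ ∘ ψ₂ = u ^ (c η) - 1` with `c η ≤ 1`, which is
handled in the same way, as are the inner pairs of the families 12 and 19.

The inner pairs of family 20 need more: `exp (L ^ γ)` with `L = log x`, `x = t + e` and `0 < γ < 1`
must have a completely monotone derivative `f`. Put `a = 1 - γ`. Then `-f'/f = q(x)/x` with
`q = 1 - (1 - a) L^(-a) + a / L`, so it suffices that `q(x)/x` is completely monotone. Writing the
negative powers of `L` as Gamma integrals gives `q(x)/x = 1/x + ∫₀^∞ w(y) x^(-1-y) dy`, where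
`w(y) = a - (1 - a) y^(a-1) / Γ(a)`, and up to a positive factor the `n`-th derivative with sign
`(-1)^n` is `1 + ∫₀^∞ w(y) φ(y) / Γ(1+y) dy` with `φ(y) = x^(-y) Γ(n+1+y) / n!`. Here `φ` is
logarithmically convex with `φ(0) = 1`, while `w(y) ≥ a (1 - y^(a-1))`, a function that changes sign
from minus to plus at `y = 1`. Hence `φ` may be replaced by its chord through `0` and `1`
(`one_add_integral_powWeight_mul_nonneg`). What is left reduces to the estimate `Γ(1+y) (1+y) ≥ 1` and
to `∫₀^∞ (y - 1) / Γ(1+y) dy = ∫₀¹ 1/Γ(y) dy ≥ 0` (`integral_sub_one_mul_inv_Gamma_nonneg`).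
-/

namespace HAC

/-! ### Functions whose derivatives alternate in sign -/

/-- `f` has `n` derivatives on `(0,∞)` and `(-1)^k f^{(k)} ≥ 0` there for all `k ≤ n`. The derivatives
are produced one at a time, so that the closure properties follow by induction on `n`. -/
def AltSign : ℕ → (ℝ → ℝ) → Prop
  | 0, f => ∀ t, 0 < t → 0 ≤ f t
  | n + 1, f => (∀ t, 0 < t → 0 ≤ f t) ∧
      ∃ g : ℝ → ℝ, (∀ t, 0 < t → HasDerivAt f (-g t) t) ∧ AltSign n g

namespace AltSign

theorem of_succ {n : ℕ} {f : ℝ → ℝ} (h : AltSign (n + 1) f) : AltSign n f := by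
  induction n generalizing f with
  | zero => exact h.1
  | succ n ih =>
    obtain ⟨h0, g, hg, hgn⟩ := h
    exact ⟨h0, g, hg, ih hgn⟩

theorem congr {n : ℕ} {f g : ℝ → ℝ} (h : AltSign n f) (hfg : ∀ t, 0 < t → f t = g t) :
    AltSign n g := by
  cases n with
  | zero => exact fun t ht => hfg t ht ▸ h t ht
  | succ n =>
    obtain ⟨h0, f', hf', hn⟩ := h
    refine ⟨fun t ht => hfg t ht ▸ h0 t ht, f', fun t ht => ?_, hn⟩
    refine (hf' t ht).congr_of_eventuallyEq ?_
    filter_upwards [Ioi_mem_nhds ht] with s hs using (hfg s hs).symm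

theorem const {n : ℕ} {c : ℝ} (hc : 0 ≤ c) : AltSign n (fun _ => c) := by
  induction n generalizing c with
  | zero => exact fun _ _ => hc
  | succ n ih => exact ⟨fun _ _ => hc, fun _ => 0, fun t _ => by simpa using hasDerivAt_const t c,
      ih le_rfl⟩

theorem add {n : ℕ} {f g : ℝ → ℝ} (hf : AltSign n f) (hg : AltSign n g) :
    AltSign n (fun t => f t + g t) := by
  induction n generalizing f g with
  | zero => exact fun t ht => add_nonneg (hf t ht) (hg t ht)
  | succ n ih =>
    obtain ⟨h0, f', hf', hfn⟩ := hf
    obtain ⟨k0, g', hg', hgn⟩ := hg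
    refine ⟨fun t ht => add_nonneg (h0 t ht) (k0 t ht), fun t => f' t + g' t, fun t ht => ?_,
      ih hfn hgn⟩
    exact ((hf' t ht).add (hg' t ht)).congr_deriv (by ring)

theorem mul {n : ℕ} {f g : ℝ → ℝ} (hf : AltSign n f) (hg : AltSign n g) :
    AltSign n (fun t => f t * g t) := by
  induction n generalizing f g with
  | zero => exact fun t ht => mul_nonneg (hf t ht) (hg t ht)
  | succ n ih =>
    have hf1 := hf.of_succ
    have hg1 := hg.of_succ
    obtain ⟨h0, f', hf', hfn⟩ := hf
    obtain ⟨k0, g', hg', hgn⟩ := hg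
    refine ⟨fun t ht => mul_nonneg (h0 t ht) (k0 t ht),
      fun t => f' t * g t + f t * g' t, fun t ht => ?_,
      (ih hfn hg1).add (ih hf1 hgn)⟩
    exact ((hf' t ht).mul (hg' t ht)).congr_deriv (by ring)

theorem const_mul {n : ℕ} {f : ℝ → ℝ} {c : ℝ} (hc : 0 ≤ c) (hf : AltSign n f) :
    AltSign n (fun t => c * f t) :=
  (const hc).mul hf

/-- The composition of a completely monotone function with a Bernstein function. -/
theorem comp {n : ℕ} {f u v : ℝ → ℝ} (hf : AltSign n f) (hu : ∀ t, 0 < t → 0 < u t)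
    (huv : ∀ t, 0 < t → HasDerivAt u (v t) t) (hv : AltSign n v) :
    AltSign n (fun t => f (u t)) := by
  induction n generalizing f with
  | zero => exact fun t ht => hf _ (hu t ht)
  | succ n ih =>
    obtain ⟨h0, f', hf', hfn⟩ := hf
    refine ⟨fun t ht => h0 _ (hu t ht), fun t => f' (u t) * v t, fun t ht => ?_,
      (ih hfn hv.of_succ).mul hv.of_succ⟩
    exact ((hf' _ (hu t ht)).comp t (huv t ht)).congr_deriv (by ring)

/-- A positive function is completely monotone if minus its logarithmic derivative is. -/
theorem of_logDeriv {n : ℕ} {f p : ℝ → ℝ} (h0 : ∀ t, 0 < t → 0 ≤ f t)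
    (hf : ∀ t, 0 < t → HasDerivAt f (-(f t * p t)) t) (hp : AltSign n p) : AltSign n f := by
  induction n with
  | zero => exact h0
  | succ n ih => exact ⟨h0, _, hf, (ih hp.of_succ).mul hp.of_succ⟩

theorem rpow_neg (n : ℕ) {c : ℝ} (hc : 0 ≤ c) : AltSign n (fun t => t ^ (-c)) := by
  induction n generalizing c with
  | zero => exact fun t ht => (Real.rpow_pos_of_pos ht _).le
  | succ n ih =>
    refine ⟨fun t ht => (Real.rpow_pos_of_pos ht _).le, fun t => c * t ^ (-(c + 1)), fun t ht => ?_,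
      (ih (c := c + 1) (by linarith)).const_mul hc⟩
    convert Real.hasDerivAt_rpow_const (p := -c) (Or.inl ht.ne') using 1
    rw [show -c - 1 = -(c + 1) by ring]
    ring

theorem rpow_of_nonpos (n : ℕ) {c : ℝ} (hc : c ≤ 0) : AltSign n (fun t => t ^ c) := by
  simpa using rpow_neg n (c := -c) (by linarith)

theorem deriv {n : ℕ} {f : ℝ → ℝ} (h : AltSign (n + 1) f) : AltSign n (fun t => -deriv f t) := by
  obtain ⟨_, g, hg, hn⟩ := h
  exact hn.congr fun t ht => by rw [(hg t ht).deriv, neg_neg]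

theorem iteratedDeriv_nonneg {n : ℕ} {f : ℝ → ℝ} (h : AltSign n f) {t : ℝ} (ht : 0 < t) :
    0 ≤ (-1 : ℝ) ^ n * iteratedDeriv n f t := by
  induction n generalizing f with
  | zero => simpa using h t ht
  | succ n ih =>
    have := ih h.deriv
    rw [iteratedDeriv_fun_neg] at this
    rw [iteratedDeriv_succ', pow_succ]
    linarith

theorem contDiffOn {n : ℕ} {f : ℝ → ℝ} (h : AltSign (n + 1) f) :
    ContDiffOn ℝ n f (Set.Ioi 0) := by
  induction n generalizing f with
  | zero =>
    obtain ⟨_, g, hg, _⟩ := h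
    rw [Nat.cast_zero, contDiffOn_zero]
    exact fun t ht => (hg t ht).continuousAt.continuousWithinAt
  | succ n ih =>
    rw [Nat.cast_succ, contDiffOn_succ_iff_deriv_of_isOpen isOpen_Ioi]
    refine ⟨fun t ht => ?_, by simp, ?_⟩
    · obtain ⟨_, g, hg, _⟩ := h
      exact (hg t ht).differentiableAt.differentiableWithinAt
    · simpa using (ih h.deriv).neg

theorem isCM {f : ℝ → ℝ} (h : ∀ n, AltSign n f) : IsCM f :=
  ⟨contDiffOn_infty.2 fun n => (h (n + 1)).contDiffOn, fun k _ ht => (h k).iteratedDeriv_nonneg ht⟩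

end AltSign

/-! ### Mixtures of negative powers -/

theorem rpow_neg_add_eq {x : ℝ} (hx : 1 < x) (c y : ℝ) :
    x ^ (-(c + y)) = x ^ (-c) * Real.exp (-(Real.log x * y)) := by
  rw [neg_add, Real.rpow_add (by linarith), Real.rpow_def_of_pos (by linarith : 0 < x) (-y)]
  ring_nf

/-- `w` is integrable on `(0,∞)` against every decaying exponential. -/
def ExpIntegrable (w : ℝ → ℝ) : Prop :=
  ∀ b : ℝ, 0 < b → MeasureTheory.IntegrableOn (fun y => w y * Real.exp (-(b * y))) (Set.Ioi 0)

namespace ExpIntegrable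

theorem rpow {s : ℝ} (hs : -1 < s) : ExpIntegrable (fun y => y ^ s) := fun b hb => by
  simpa using integrableOn_rpow_mul_exp_neg_mul_rpow hs one_pos hb

theorem const (c : ℝ) : ExpIntegrable (fun _ => c) := fun b hb => by
  have := MeasureTheory.Integrable.const_mul (rpow (s := 0) (by norm_num) b hb) c
  simpa [MeasureTheory.IntegrableOn] using this

theorem const_mul {w : ℝ → ℝ} (hw : ExpIntegrable w) (c : ℝ) :
    ExpIntegrable (fun y => c * w y) := fun b hb => by
  simpa [MeasureTheory.IntegrableOn, mul_assoc] using MeasureTheory.Integrable.const_mul (hw b hb) c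

theorem sub {w v : ℝ → ℝ} (hw : ExpIntegrable w) (hv : ExpIntegrable v) :
    ExpIntegrable (fun y => w y - v y) := fun b hb => by
  have := (hw b hb).sub (hv b hb)
  refine this.congr (Filter.Eventually.of_forall fun y => ?_)
  simp [sub_mul]

theorem add_mul {w : ℝ → ℝ} (hw : ExpIntegrable w) {c : ℝ} (hc : 0 ≤ c) :
    ExpIntegrable (fun y => (c + y) * w y) := fun b hb => by
  have h2 : 0 < b / 2 := by positivity
  -- half of the exponential absorbs the linear factor
  have hbd : MeasureTheory.Integrable (fun y => ((c + y) * Real.exp (-(b / 2 * y))) *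
      (w y * Real.exp (-(b / 2 * y)))) (MeasureTheory.volume.restrict (Set.Ioi 0)) := by
    refine (hw _ h2).bdd_mul (c := c + 2 / b) ?_ ?_
    · exact (by fun_prop : Continuous fun y : ℝ =>
        (c + y) * Real.exp (-(b / 2 * y))).aestronglyMeasurable
    · refine (MeasureTheory.ae_restrict_mem measurableSet_Ioi).mono fun y hy => ?_
      have hy : 0 < y := hy
      rw [Real.norm_of_nonneg (by positivity), Real.exp_neg, mul_inv_le_iff₀ (Real.exp_pos _)]
      have h1 := Real.add_one_le_exp (b / 2 * y)
      have h3 : 1 ≤ Real.exp (b / 2 * y) := Real.one_le_exp (by positivity)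
      calc c + y ≤ c * 1 + 2 / b * (b / 2 * y + 1) := by
            rw [mul_add, ← mul_assoc, show 2 / b * (b / 2) = 1 by field_simp]
            have : 0 < 2 / b := by positivity
            linarith
        _ ≤ c * Real.exp (b / 2 * y) + 2 / b * Real.exp (b / 2 * y) := by gcongr
        _ = _ := by ring
  refine hbd.congr (Filter.Eventually.of_forall fun y => ?_)
  have : Real.exp (-(b * y)) = Real.exp (-(b / 2 * y)) * Real.exp (-(b / 2 * y)) := by
    rw [← Real.exp_add]; ring_nf
  simp only [this]
  ring

theorem integrableOn_rpow {w : ℝ → ℝ} (hw : ExpIntegrable w) (c : ℝ) {x : ℝ} (hx : 1 < x) :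
    MeasureTheory.IntegrableOn (fun y => w y * x ^ (-(c + y))) (Set.Ioi 0) := by
  have := (hw _ (Real.log_pos hx)).const_mul (x ^ (-c))
  refine this.congr (Filter.Eventually.of_forall fun y => ?_)
  simp only [rpow_neg_add_eq hx]
  ring

/-- Differentiation under the integral sign of a mixture of negative powers. -/
theorem hasDerivAt_integral {w : ℝ → ℝ} (hw : ExpIntegrable w) {c : ℝ} (hc : 0 ≤ c) {x : ℝ}
    (hx : 1 < x) :
    HasDerivAt (fun x => ∫ y in Set.Ioi (0 : ℝ), w y * x ^ (-(c + y)))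
      (-∫ y in Set.Ioi (0 : ℝ), ((c + y) * w y) * x ^ (-(c + 1 + y))) x := by
  obtain ⟨x₁, h1, hx1⟩ := exists_between hx
  have hw' := hw.add_mul hc
  have := hasDerivAt_integral_of_dominated_loc_of_deriv_le
    (μ := MeasureTheory.volume.restrict (Set.Ioi (0 : ℝ)))
    (F := fun x y => w y * x ^ (-(c + y)))
    (F' := fun x y => -(((c + y) * w y) * x ^ (-(c + 1 + y))))
    (bound := fun y => ‖((c + y) * w y) * x₁ ^ (-(c + 1 + y))‖) (Ioi_mem_nhds hx1)
    ?_ (hw.integrableOn_rpow c hx) (hw'.integrableOn_rpow (c + 1) hx).neg.aestronglyMeasurable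
    ?_ (hw'.integrableOn_rpow (c + 1) h1).norm ?_
  · simpa only [MeasureTheory.integral_neg] using this.2
  · filter_upwards [Ioi_mem_nhds hx] with z hz
    exact (hw.integrableOn_rpow c hz).aestronglyMeasurable
  · refine (MeasureTheory.ae_restrict_mem measurableSet_Ioi).mono fun y hy z hz => ?_
    have hy : 0 < y := hy
    have hz : x₁ < z := hz
    have h0 : 0 < z := by linarith
    rw [norm_neg, norm_mul, norm_mul ((c + y) * w y)]
    refine mul_le_mul_of_nonneg_left ?_ (norm_nonneg _)
    rw [Real.norm_of_nonneg (by positivity), Real.norm_of_nonneg (by positivity)]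
    exact Real.rpow_le_rpow_of_nonpos (by linarith) hz.le (by linarith)
  · refine Filter.Eventually.of_forall fun y z hz => ?_
    have hz : x₁ < z := hz
    have h0 : z ≠ 0 := by linarith
    refine ((Real.hasDerivAt_rpow_const (p := -(c + y)) (Or.inl h0)).const_mul
      (w y)).congr_deriv ?_
    rw [show -(c + y) - 1 = -(c + 1 + y) by ring]
    ring

end ExpIntegrable

/-! ### The reciprocal Gamma function -/

/-- `e^{-Ly} Γ(n+1+y) / n!` is convex in `y ≥ 0`, being logarithmically convex. -/
theorem convexOn_exp_mul_Gamma (n : ℕ) (L : ℝ) :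
    ConvexOn ℝ (Set.Ici (0 : ℝ))
      (fun y => Real.exp (-(L * y)) * Real.Gamma (n + 1 + y) / n.factorial) := by
  have h1 : ConvexOn ℝ (Set.Ici (0 : ℝ))
      (fun y => Real.log (Real.Gamma (n + 1 + y)) + -(L * y)) := by
    refine ConvexOn.add ?_ ?_
    · refine ⟨convex_Ici _, fun x hx y hy s t hs ht hst => ?_⟩
      have hx : 0 ≤ x := hx
      have hy : 0 ≤ y := hy
      have := Real.convexOn_log_Gamma.2 (x := n + 1 + x) (y := n + 1 + y)
        (show (0 : ℝ) < n + 1 + x by positivity) (show (0 : ℝ) < n + 1 + y by positivity) hs ht hst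
      simp only [smul_eq_mul, Function.comp] at this ⊢
      convert this using 3
      linear_combination (-(n : ℝ) - 1) * hst
    · refine ⟨convex_Ici _, fun x _ y _ s t _ _ _ => le_of_eq ?_⟩
      simp only [smul_eq_mul]
      ring
  have h2 : ConvexOn ℝ (Set.Ici (0 : ℝ))
      (fun y => Real.exp (Real.log (Real.Gamma (n + 1 + y)) + -(L * y))) := by
    refine ⟨convex_Ici _, fun x hx y hy s t hs ht hst => ?_⟩
    exact (Real.exp_le_exp.2 (h1.2 hx hy hs ht hst)).trans
      (convexOn_exp.2 trivial trivial hs ht hst)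
  refine (h2.smul (c := ((n.factorial : ℝ))⁻¹) (by positivity)).congr fun y hy => ?_
  have hy : 0 ≤ y := hy
  simp only [smul_eq_mul]
  rw [Real.exp_add, Real.exp_log (Real.Gamma_pos_of_pos (by positivity))]
  ring

theorem le_chord {φ : ℝ → ℝ} (hφ : ConvexOn ℝ (Set.Ici (0 : ℝ)) φ) (h0 : φ 0 = 1) {y : ℝ}
    (hy0 : 0 ≤ y) (hy1 : y ≤ 1) : φ y ≤ 1 + (φ 1 - 1) * y := by
  have := hφ.2 (x := 0) (y := 1) Set.self_mem_Ici (by simp) (sub_nonneg.2 hy1) hy0 (by ring)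
  simp only [smul_eq_mul, mul_zero, mul_one, zero_add, h0] at this
  linarith

theorem chord_le {φ : ℝ → ℝ} (hφ : ConvexOn ℝ (Set.Ici (0 : ℝ)) φ) (h0 : φ 0 = 1) {y : ℝ}
    (hy1 : 1 ≤ y) : 1 + (φ 1 - 1) * y ≤ φ y := by
  have hy : 0 < y := by linarith
  have h1 : 0 ≤ 1 - 1 / y := sub_nonneg.2 ((div_le_one hy).2 hy1)
  have h2 : 0 ≤ 1 / y := by positivity
  have := hφ.2 Set.self_mem_Ici (Set.mem_Ici.2 hy.le) h1 h2 (by ring)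
  simp only [smul_eq_mul, mul_zero, mul_one, zero_add, h0, one_div_mul_cancel hy.ne'] at this
  have := mul_le_mul_of_nonneg_right this hy.le
  rw [_root_.add_mul, sub_mul, one_div_mul_cancel hy.ne', mul_right_comm,
    one_div_mul_cancel hy.ne'] at this
  linarith

/-- `Γ` is convex and takes the value `1` at both `1` and `2`. -/
theorem one_le_Gamma_two_add {y : ℝ} (hy : 0 ≤ y) : 1 ≤ Real.Gamma (2 + y) := by
  have h0 : ConvexOn ℝ (Set.Ici (0 : ℝ)) (fun y => Real.Gamma (1 + y)) := by
    simpa using convexOn_exp_mul_Gamma 0 0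
  have := chord_le h0 (by simp) (y := 1 + y) (by linarith)
  norm_num [← add_assoc] at this
  exact this

theorem Gamma_one_add_pos {y : ℝ} (hy : 0 ≤ y) : 0 < Real.Gamma (1 + y) :=
  Real.Gamma_pos_of_pos (by linarith)

theorem Gamma_two_add {y : ℝ} (hy : 0 ≤ y) :
    Real.Gamma (2 + y) = (1 + y) * Real.Gamma (1 + y) := by
  rw [← Real.Gamma_add_one (by linarith)]
  ring_nf

theorem inv_Gamma_le {y : ℝ} (hy : 0 ≤ y) : (Real.Gamma (1 + y))⁻¹ ≤ 1 + y := by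
  rw [inv_le_iff_one_le_mul₀ (Gamma_one_add_pos hy), ← Gamma_two_add hy]
  exact one_le_Gamma_two_add hy

theorem one_sub_le_Gamma {a : ℝ} (ha : 0 ≤ a) : 1 - a ≤ Real.Gamma (1 + a) := by
  have h1 := one_le_Gamma_two_add ha
  rw [Gamma_two_add ha] at h1
  nlinarith [Gamma_one_add_pos ha]

/-- Exponential decay of the reciprocal Gamma function. The base `3/2` could be any number between
`1` and `2`: the chord of the convex function `(3/2)^(-y) Γ(2+y)` through `0` and `1` increases. -/
theorem inv_Gamma_le_exp {y : ℝ} (hy : 0 ≤ y) :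
    (Real.Gamma (1 + y))⁻¹ ≤ (1 + y) * (2 * Real.exp (-(Real.log (3 / 2) * y))) := by
  have key : 1 ≤ 2 * Real.exp (-(Real.log (3 / 2) * y)) * Real.Gamma (2 + y) := by
    have hG := one_le_Gamma_two_add hy
    have hl : Real.exp (-Real.log (3 / 2)) = 2 / 3 := by
      rw [Real.exp_neg, Real.exp_log (by norm_num)]; norm_num
    rcases le_total y 1 with h1 | h1
    · have : 2 / 3 ≤ Real.exp (-(Real.log (3 / 2) * y)) := by
        rw [← hl, Real.exp_le_exp]
        have : 0 < Real.log (3 / 2) := Real.log_pos (by norm_num)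
        nlinarith
      nlinarith
    · have h0 := convexOn_exp_mul_Gamma 1 (Real.log (3 / 2))
      have := chord_le h0 (by norm_num [Real.Gamma_two]) h1
      have h3 : Real.Gamma (1 + 1 + 1) = 2 := by
        rw [Real.Gamma_add_one (by norm_num), one_add_one_eq_two, Real.Gamma_two]; norm_num
      simp only [Nat.cast_one, mul_one, Nat.factorial_one, div_one, h3, hl] at this
      rw [one_add_one_eq_two] at this
      nlinarith
  rw [inv_le_iff_one_le_mul₀ (Gamma_one_add_pos hy)]
  rw [Gamma_two_add hy] at key
  linarith

theorem continuousOn_inv_Gamma :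
    ContinuousOn (fun y : ℝ => (Real.Gamma (1 + y))⁻¹) (Set.Ioi 0) := by
  intro y hy
  have hy : 0 < y := hy
  have h : ContinuousAt Real.Gamma (1 + y) :=
    (Real.differentiableAt_Gamma fun m => by
      have : (0 : ℝ) ≤ m := Nat.cast_nonneg m
      linarith).continuousAt
  exact ((ContinuousAt.comp (f := fun y : ℝ => 1 + y) h (by fun_prop)).inv₀
    (Gamma_one_add_pos hy.le).ne').continuousWithinAt

theorem integrableOn_inv_Gamma :
    MeasureTheory.IntegrableOn (fun y : ℝ => (Real.Gamma (1 + y))⁻¹) (Set.Ioi 0) := by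
  have hl : 0 < Real.log (3 / 2) := Real.log_pos (by norm_num)
  refine MeasureTheory.Integrable.mono'
    (((ExpIntegrable.const 2).add_mul zero_le_one) _ hl)
    (continuousOn_inv_Gamma.aestronglyMeasurable measurableSet_Ioi) ?_
  refine (MeasureTheory.ae_restrict_mem measurableSet_Ioi).mono fun y hy => ?_
  have hy : 0 < y := hy
  rw [Real.norm_of_nonneg (inv_nonneg.2 (Gamma_one_add_pos hy.le).le), mul_assoc]
  exact inv_Gamma_le_exp hy.le

theorem mul_inv_Gamma {y : ℝ} (hy : 0 < y) :
    y * (Real.Gamma (1 + y))⁻¹ = (Real.Gamma y)⁻¹ := by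
  have := (Real.Gamma_pos_of_pos hy).ne'
  rw [add_comm, Real.Gamma_add_one hy.ne']
  field_simp

theorem integrableOn_mul_inv_Gamma :
    MeasureTheory.IntegrableOn (fun y : ℝ => y * (Real.Gamma (1 + y))⁻¹) (Set.Ioi 0) := by
  have hl : 0 < Real.log (3 / 2) := Real.log_pos (by norm_num)
  refine MeasureTheory.Integrable.mono'
    ((((ExpIntegrable.const 2).add_mul zero_le_one).add_mul le_rfl) _ hl)
    ((continuousOn_id.mul continuousOn_inv_Gamma).aestronglyMeasurable measurableSet_Ioi) ?_
  refine (MeasureTheory.ae_restrict_mem measurableSet_Ioi).mono fun y hy => ?_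
  have hy : 0 < y := hy
  rw [Real.norm_of_nonneg (mul_nonneg hy.le (inv_nonneg.2 (Gamma_one_add_pos hy.le).le)),
    show (0 + y) * ((1 + y) * 2) * Real.exp (-(Real.log (3 / 2) * y)) =
      y * ((1 + y) * (2 * Real.exp (-(Real.log (3 / 2) * y)))) by ring]
  exact mul_le_mul_of_nonneg_left (inv_Gamma_le_exp hy.le) hy.le

/-- The integral equals `∫₀¹ 1/Γ`, because `y/Γ(1+y) = 1/Γ(y)`. -/
theorem integral_sub_one_mul_inv_Gamma_nonneg :
    0 ≤ ∫ y in Set.Ioi (0 : ℝ), (y - 1) * (Real.Gamma (1 + y))⁻¹ := by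
  have hI := integrableOn_mul_inv_Gamma.congr_fun (fun y hy => mul_inv_Gamma hy) measurableSet_Ioi
  have hshift : ∫ y in Set.Ioi (0 : ℝ), (Real.Gamma (1 + y))⁻¹ =
      ∫ y in Set.Ioi (1 : ℝ), (Real.Gamma y)⁻¹ := by
    have := (MeasureTheory.measurePreserving_add_left MeasureTheory.volume
      (1 : ℝ)).setIntegral_preimage_emb (measurableEmbedding_addLeft 1)
      (fun y => (Real.Gamma y)⁻¹) (Set.Ioi 1)
    simpa using this
  have hle : ∫ y in Set.Ioi (1 : ℝ), (Real.Gamma y)⁻¹ ≤ ∫ y in Set.Ioi (0 : ℝ), (Real.Gamma y)⁻¹ :=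
    MeasureTheory.setIntegral_mono_set hI
      ((MeasureTheory.ae_restrict_mem measurableSet_Ioi).mono fun y hy =>
        inv_nonneg.2 (Real.Gamma_pos_of_pos hy).le)
      (Set.Ioi_subset_Ioi zero_le_one).eventuallyLE
  simp only [sub_mul, one_mul]
  rw [MeasureTheory.integral_sub integrableOn_mul_inv_Gamma integrableOn_inv_Gamma, hshift,
    MeasureTheory.setIntegral_congr_fun measurableSet_Ioi fun y hy => mul_inv_Gamma hy]
  linarith

/-! ### The weight and its moments -/

/-- The weight with `1 - (1 - a) L^(-a) + a / L = 1 + ∫₀^∞ w(y) e^{-Ly} dy` for `L > 0`. -/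
noncomputable def powWeight (a y : ℝ) : ℝ := a - (1 - a) / Real.Gamma a * y ^ (a - 1)

theorem expIntegrable_powWeight {a : ℝ} (ha : 0 < a) : ExpIntegrable (powWeight a) :=
  (ExpIntegrable.const a).sub ((ExpIntegrable.rpow (by linarith)).const_mul _)

theorem powWeight_ge {a y : ℝ} (ha : 0 < a) (hy : 0 < y) :
    a * (1 - y ^ (a - 1)) ≤ powWeight a y := by
  have hG := Real.Gamma_pos_of_pos ha
  have h : (1 - a) / Real.Gamma a ≤ a := by
    rw [div_le_iff₀ hG, ← Real.Gamma_add_one ha.ne', add_comm]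
    exact one_sub_le_Gamma ha.le
  have := mul_le_mul_of_nonneg_right h (Real.rpow_pos_of_pos hy (a - 1)).le
  unfold powWeight
  linarith

theorem one_add_integral_powWeight {a L : ℝ} (ha : 0 < a) (hL : 0 < L) :
    1 + ∫ y in Set.Ioi (0 : ℝ), powWeight a y * Real.exp (-(L * y)) =
      1 - (1 - a) * L ^ (-a) + a / L := by
  have h1 := Real.integral_rpow_mul_exp_neg_mul_Ioi ha hL
  have h2 := Real.integral_rpow_mul_exp_neg_mul_Ioi one_pos hL
  simp only [sub_self, Real.rpow_zero, one_mul, Real.rpow_one, Real.Gamma_one, mul_one] at h2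
  have e : ∀ y : ℝ, powWeight a y * Real.exp (-(L * y)) =
      a * Real.exp (-(L * y)) -
        (1 - a) / Real.Gamma a * (y ^ (a - 1) * Real.exp (-(L * y))) := fun y => by
    unfold powWeight; ring
  have i1 := (ExpIntegrable.const a) L hL
  have i2 := MeasureTheory.Integrable.const_mul
    ((ExpIntegrable.rpow (s := a - 1) (by linarith)) L hL) ((1 - a) / Real.Gamma a)
  simp only [e]
  rw [MeasureTheory.integral_sub i1 i2, MeasureTheory.integral_const_mul,
    MeasureTheory.integral_const_mul, h1, h2, one_div, Real.inv_rpow hL.le, Real.rpow_neg hL.le]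
  have := (Real.Gamma_pos_of_pos ha).ne'
  field_simp
  ring

theorem rpow_sub_self_le {a y : ℝ} (ha0 : 0 ≤ a) (ha1 : a ≤ 1) (hy : 0 < y) :
    y ^ a - y ≤ (1 - a) * (1 - y) := by
  have := rpow_one_add_le_one_add_mul_self (s := y - 1) (by linarith) ha0 ha1
  rw [add_sub_cancel] at this
  linarith

/-- For convex `φ ≥ 0` with `φ 0 = 1` the integral of `powWeight a * φ / Γ(1 + ·)` is at least `-1`.
The lower bound `a (1 - y^(a-1))` of the weight changes sign at `1`, where the chord of `φ` through
`0` and `1` crosses `φ`; so `φ` can be replaced by this chord. -/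
theorem one_add_integral_powWeight_mul_nonneg {a : ℝ} (ha0 : 0 < a) (ha1 : a ≤ 1) {φ : ℝ → ℝ}
    (hφ : ConvexOn ℝ (Set.Ici (0 : ℝ)) φ) (h0 : φ 0 = 1) (hpos : ∀ y, 0 ≤ y → 0 ≤ φ y)
    (hint : MeasureTheory.IntegrableOn
      (fun y => powWeight a y * φ y * (Real.Gamma (1 + y))⁻¹) (Set.Ioi 0)) :
    0 ≤ 1 + ∫ y in Set.Ioi (0 : ℝ), powWeight a y * φ y * (Real.Gamma (1 + y))⁻¹ := by
  -- `g₁` bounds the part of the integrand coming from the value `1` of the chord at `0`, and `g₂` the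
  -- part coming from its slope; a negative slope is dropped, as `φ ≤ 1` on `[0, 1]` and `φ ≥ 0` after
  set g₁ : ℝ → ℝ := (Set.Ioc (0 : ℝ) 1).indicator (fun y => a * (1 - y ^ (a - 1)) * (1 + y))
    with hg₁
  set g₂ : ℝ → ℝ := fun y => max (φ 1 - 1) 0 * (a * (1 - a)) *
    ((y - 1) * (Real.Gamma (1 + y))⁻¹) with hg₂
  have hm : 0 ≤ max (φ 1 - 1) 0 := le_max_right _ _
  have hexp : ∀ y ∈ Set.Ioc (0 : ℝ) 1, a * (1 - y ^ (a - 1)) * (1 + y) =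
      (a + a * y) - (a * y ^ (a - 1) + a * y ^ a) := fun y hy => by
    rw [show y ^ a = y ^ (a - 1) * y by rw [← Real.rpow_add_one hy.1.ne', sub_add_cancel]]
    ring
  have hi1 : IntervalIntegrable (fun y : ℝ => a + a * y) MeasureTheory.volume 0 1 :=
    (by fun_prop : Continuous fun y : ℝ => a + a * y).intervalIntegrable _ _
  have hi2 : IntervalIntegrable (fun y : ℝ => a * y ^ (a - 1)) MeasureTheory.volume 0 1 :=
    (intervalIntegral.intervalIntegrable_rpow' (by linarith)).const_mul a
  have hi3 : IntervalIntegrable (fun y : ℝ => a * y ^ a) MeasureTheory.volume 0 1 :=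
    (intervalIntegral.intervalIntegrable_rpow' (by linarith)).const_mul a
  have hi4 := hi1.sub (hi2.add hi3)
  have hIoc : MeasureTheory.IntegrableOn
      (fun y : ℝ => a * (1 - y ^ (a - 1)) * (1 + y)) (Set.Ioc 0 1) :=
    ((intervalIntegrable_iff_integrableOn_Ioc_of_le zero_le_one).1 hi4).congr_fun
      (fun y hy => (hexp y hy).symm) measurableSet_Ioc
  have hg₁i : MeasureTheory.IntegrableOn g₁ (Set.Ioi 0) :=
    ((MeasureTheory.integrable_indicator_iff measurableSet_Ioc).2 hIoc).integrableOn
  have hg₂i : MeasureTheory.IntegrableOn g₂ (Set.Ioi 0) := by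
    refine MeasureTheory.Integrable.const_mul ?_ _
    refine (integrableOn_mul_inv_Gamma.sub integrableOn_inv_Gamma).congr
      (Filter.Eventually.of_forall fun y => ?_)
    simp only [Pi.sub_apply]
    ring
  have hI₁ : -1 ≤ ∫ y in Set.Ioi (0 : ℝ), g₁ y := by
    rw [hg₁, MeasureTheory.setIntegral_indicator measurableSet_Ioc,
      Set.inter_eq_self_of_subset_right Set.Ioc_subset_Ioi_self,
      MeasureTheory.setIntegral_congr_fun measurableSet_Ioc hexp,
      ← intervalIntegral.integral_of_le zero_le_one, intervalIntegral.integral_sub hi1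
        (hi2.add hi3), intervalIntegral.integral_add (by simp) (by
          exact (by fun_prop : Continuous fun y : ℝ => a * y).intervalIntegrable _ _),
      intervalIntegral.integral_add hi2 hi3,
      intervalIntegral.integral_const_mul, intervalIntegral.integral_const_mul,
      intervalIntegral.integral_const_mul, integral_rpow (Or.inl (by linarith)),
      integral_rpow (Or.inl (by linarith)), integral_id, intervalIntegral.integral_const]
    have h3 : (0 : ℝ) ^ (a + 1) = 0 := Real.zero_rpow (by linarith)
    simp only [sub_add_cancel, Real.one_rpow, Real.zero_rpow ha0.ne', h3]
    norm_num
    have : a * (a + 1)⁻¹ ≤ a := mul_le_of_le_one_right ha0.le (inv_le_one_of_one_le₀ (by linarith))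
    rw [mul_inv_cancel₀ ha0.ne']
    linarith
  have hI₂ : 0 ≤ ∫ y in Set.Ioi (0 : ℝ), g₂ y := by
    rw [hg₂, MeasureTheory.integral_const_mul]
    exact mul_nonneg (mul_nonneg hm (mul_nonneg ha0.le (sub_nonneg.2 ha1)))
      integral_sub_one_mul_inv_Gamma_nonneg
  have hle : ∫ y in Set.Ioi (0 : ℝ), (g₁ y + g₂ y) ≤
      ∫ y in Set.Ioi (0 : ℝ), powWeight a y * φ y * (Real.Gamma (1 + y))⁻¹ := by
    refine MeasureTheory.setIntegral_mono_on (hg₁i.add hg₂i) hint measurableSet_Ioi fun y hy => ?_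
    have hy : 0 < y := hy
    have hw := powWeight_ge ha0 hy
    have hG := inv_pos.2 (Gamma_one_add_pos hy.le)
    have hG1 := inv_Gamma_le hy.le
    have hφy := hpos y hy.le
    have hya := rpow_sub_self_le ha0.le ha1 hy
    rw [show y ^ a = y ^ (a - 1) * y by rw [← Real.rpow_add_one hy.ne', sub_add_cancel]] at hya
    set p := y ^ (a - 1)
    set G := (Real.Gamma (1 + y))⁻¹
    set m := max (φ 1 - 1) 0
    have hma : 0 ≤ m * a := mul_nonneg hm ha0.le
    have hmain : m * (a * (1 - a)) * ((y - 1) * G) ≤ a * (1 - p) * (m * y) * G := by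
      have := mul_le_mul_of_nonneg_left hya (mul_nonneg hma hG.le)
      linarith
    have hw' : a * (1 - p) * φ y * G ≤ powWeight a y * φ y * G := by gcongr
    refine le_trans ?_ hw'
    rcases le_or_gt y 1 with h1 | h1
    · have hp : 1 ≤ p := Real.one_le_rpow_of_pos_of_le_one_of_nonpos hy h1 (by linarith)
      have hc := le_chord hφ h0 hy.le h1
      have hc' : φ y ≤ 1 + m * y := hc.trans (by gcongr; exact le_max_left _ _)
      have hmem : y ∈ Set.Ioc (0 : ℝ) 1 := Set.mem_Ioc.2 ⟨hy, h1⟩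
      rw [hg₁, Set.indicator_of_mem hmem]
      have hap : 0 ≤ a * (p - 1) := mul_nonneg ha0.le (by linarith)
      have e1 := mul_le_mul_of_nonneg_left hc' (mul_nonneg hap hG.le)
      have e2 := mul_le_mul_of_nonneg_left hG1 hap
      simp only [hg₂]
      linarith
    · have hp : p ≤ 1 := Real.rpow_le_one_of_one_le_of_nonpos h1.le (by linarith)
      have hc := chord_le hφ h0 h1.le
      have hc' : m * y ≤ φ y := by
        rcases max_cases (φ 1 - 1) 0 with ⟨h, _⟩ | ⟨h, _⟩
        · rw [show m = φ 1 - 1 from h]; linarith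
        · rw [show m = 0 from h]; simpa using hφy
      rw [hg₁, Set.indicator_of_notMem (by simp [h1])]
      have e1 := mul_le_mul_of_nonneg_left hc'
        (mul_nonneg (mul_nonneg ha0.le (sub_nonneg.2 hp)) hG.le)
      simp only [hg₂]
      linarith
  rw [MeasureTheory.integral_add hg₁i hg₂i] at hle
  linarith

/-! ### Complete monotonicity of the derivative of `exp (log (t + e) ^ γ)` -/

theorem prod_add_eq_Gamma_div (n : ℕ) {y : ℝ} (hy : 0 ≤ y) :
    ∏ k ∈ Finset.range n, ((k : ℝ) + 1 + y) =
      Real.Gamma (n + 1 + y) * (Real.Gamma (1 + y))⁻¹ := by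
  induction n with
  | zero => simp [(Gamma_one_add_pos hy).ne']
  | succ n ih =>
    rw [Finset.prod_range_succ, ih, Nat.cast_succ, show (n : ℝ) + 1 + 1 + y = n + 1 + y + 1 by ring,
      Real.Gamma_add_one (by positivity)]
    ring

theorem expIntegrable_prod_mul {w : ℝ → ℝ} (hw : ExpIntegrable w) (n : ℕ) :
    ExpIntegrable (fun y => (∏ k ∈ Finset.range n, ((k : ℝ) + 1 + y)) * w y) := by
  induction n with
  | zero => simpa using hw
  | succ n ih =>
    have := ih.add_mul (c := (n : ℝ) + 1) (by positivity)
    simpa only [Finset.prod_range_succ, mul_assoc, mul_left_comm, mul_comm] using this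

/-- The sign of the `n`-th derivative of `q(x)/x` for `L = log x`, with the polynomial factor written
as `Γ(n+1+y) / Γ(1+y)`. -/
theorem factorial_add_integral_nonneg {a L : ℝ} (ha0 : 0 < a) (ha1 : a ≤ 1) (hL : 0 < L) (n : ℕ) :
    0 ≤ (n.factorial : ℝ) + ∫ y in Set.Ioi (0 : ℝ),
      ((∏ k ∈ Finset.range n, ((k : ℝ) + 1 + y)) * powWeight a y) * Real.exp (-(L * y)) := by
  have hn : (0 : ℝ) < n.factorial := by positivity
  have e : ∀ y ∈ Set.Ioi (0 : ℝ),
      ((∏ k ∈ Finset.range n, ((k : ℝ) + 1 + y)) * powWeight a y) * Real.exp (-(L * y)) =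
      n.factorial * (powWeight a y * (Real.exp (-(L * y)) * Real.Gamma (n + 1 + y) / n.factorial) *
        (Real.Gamma (1 + y))⁻¹) := fun y hy => by
    rw [prod_add_eq_Gamma_div n (le_of_lt hy)]
    field_simp
  have hint := (expIntegrable_prod_mul (expIntegrable_powWeight ha0) n L hL).congr_fun e
    measurableSet_Ioi
  have hint' := MeasureTheory.Integrable.const_mul hint ((n.factorial : ℝ)⁻¹)
  rw [MeasureTheory.setIntegral_congr_fun measurableSet_Ioi e, MeasureTheory.integral_const_mul]
  have := one_add_integral_powWeight_mul_nonneg ha0 ha1 (convexOn_exp_mul_Gamma n L)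
    (by simp [Real.Gamma_nat_eq_factorial, hn.ne'])
    (fun y hy => by
      have := Real.Gamma_pos_of_pos (by positivity : 0 < (n : ℝ) + 1 + y)
      positivity)
    (by simpa only [MeasureTheory.IntegrableOn, inv_mul_cancel_left₀ hn.ne'] using hint')
  nlinarith

/-- The function `(-1)^n (d/dx)^n (q(x)/x)`, where `q = 1 - (1 - a) L^(-a) + a / L`, `L = log x`. -/
noncomputable def quotDeriv (a : ℝ) (n : ℕ) (x : ℝ) : ℝ :=
  n.factorial * x ^ (-((n : ℝ) + 1)) + ∫ y in Set.Ioi (0 : ℝ),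
    ((∏ k ∈ Finset.range n, ((k : ℝ) + 1 + y)) * powWeight a y) * x ^ (-((n : ℝ) + 1 + y))

theorem hasDerivAt_quotDeriv {a x : ℝ} (ha : 0 < a) (hx : 1 < x) (n : ℕ) :
    HasDerivAt (quotDeriv a n) (-quotDeriv a (n + 1) x) x := by
  have hc : (0 : ℝ) ≤ n + 1 := by positivity
  have h1 := (Real.hasDerivAt_rpow_const (p := -((n : ℝ) + 1))
    (Or.inl (by linarith : x ≠ 0))).const_mul (n.factorial : ℝ)
  have h2 := (expIntegrable_prod_mul (expIntegrable_powWeight ha) n).hasDerivAt_integral hc hx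
  refine (h1.add h2).congr_deriv ?_
  unfold quotDeriv
  rw [Nat.factorial_succ, show -((n : ℝ) + 1) - 1 = -((n : ℝ) + 1 + 1) by ring]
  simp only [Finset.prod_range_succ]
  push_cast
  have e : ∀ y : ℝ, ((∏ k ∈ Finset.range n, ((k : ℝ) + 1 + y)) * (n + 1 + y)) * powWeight a y =
      (n + 1 + y) * ((∏ k ∈ Finset.range n, ((k : ℝ) + 1 + y)) * powWeight a y) := fun y => by ring
  simp only [e]
  ring

theorem quotDeriv_eq {a x : ℝ} (hx : 1 < x) (n : ℕ) :
    quotDeriv a n x = x ^ (-((n : ℝ) + 1)) * (n.factorial + ∫ y in Set.Ioi (0 : ℝ),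
      ((∏ k ∈ Finset.range n, ((k : ℝ) + 1 + y)) * powWeight a y) *
        Real.exp (-(Real.log x * y))) := by
  unfold quotDeriv
  rw [mul_add, ← MeasureTheory.integral_const_mul]
  simp only [rpow_neg_add_eq hx]
  congr 1
  · ring
  · congr 1
    ext y
    ring

/-- `q(x)/x` and its derivatives, taken with alternating signs, are completely monotone in
`t = x - e`. -/
theorem altSign_quotDeriv {a : ℝ} (ha0 : 0 < a) (ha1 : a ≤ 1) (m n : ℕ) :
    AltSign m (fun t => quotDeriv a n (t + Real.exp 1)) := by
  have he : 1 < Real.exp 1 := Real.one_lt_exp_iff.2 one_pos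
  have h0 : ∀ (n : ℕ) (t : ℝ), 0 < t → 0 ≤ quotDeriv a n (t + Real.exp 1) := fun n t ht => by
    have hx : 1 < t + Real.exp 1 := by linarith
    rw [quotDeriv_eq hx]
    exact mul_nonneg (by positivity)
      (factorial_add_integral_nonneg ha0 ha1 (Real.log_pos hx) n)
  induction m generalizing n with
  | zero => exact h0 n
  | succ m ih =>
    exact ⟨h0 n, _, fun t ht =>
      (hasDerivAt_quotDeriv ha0 (by linarith) n).comp_add_const t (Real.exp 1), ih (n + 1)⟩

theorem hasDerivAt_log_add {c t : ℝ} (h : 0 < t + c) :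
    HasDerivAt (fun s => Real.log (s + c)) (t + c)⁻¹ t :=
  (Real.hasDerivAt_log h.ne').comp_add_const t c

theorem hasDerivAt_exp_log_rpow {γ t : ℝ} (ht : 0 < t) :
    HasDerivAt (fun s => Real.exp (Real.log (s + Real.exp 1) ^ γ))
      (γ * Real.log (t + Real.exp 1) ^ (γ - 1) * Real.exp (Real.log (t + Real.exp 1) ^ γ) *
        (t + Real.exp 1)⁻¹) t := by
  have he : 1 < Real.exp 1 := Real.one_lt_exp_iff.2 one_pos
  have hL : 0 < Real.log (t + Real.exp 1) := Real.log_pos (by linarith)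
  refine (((hasDerivAt_log_add (by linarith)).rpow_const (Or.inl hL.ne')).exp).congr_deriv ?_
  ring

/-- The derivative of `exp (log (t + e) ^ γ)` is completely monotone, because minus its logarithmic
derivative is `q(x)/x` with `x = t + e` and `a = 1 - γ`. -/
theorem altSign_deriv_exp_log_rpow (n : ℕ) {γ : ℝ} (h0 : 0 < γ) (h1 : γ ≤ 1) :
    AltSign n (fun t => γ * Real.log (t + Real.exp 1) ^ (γ - 1) *
      Real.exp (Real.log (t + Real.exp 1) ^ γ) * (t + Real.exp 1)⁻¹) := by
  have he : 1 < Real.exp 1 := Real.one_lt_exp_iff.2 one_pos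
  rcases h1.eq_or_lt with rfl | h1
  · refine (AltSign.const zero_le_one).congr fun t ht => ?_
    have : 0 < t + Real.exp 1 := by linarith
    simp [Real.exp_log this, this.ne']
  have ha0 : 0 < 1 - γ := by linarith
  refine AltSign.of_logDeriv (p := fun t => quotDeriv (1 - γ) 0 (t + Real.exp 1))
    (fun t ht => ?_) (fun t ht => ?_) (altSign_quotDeriv ha0 (by linarith) n 0)
  · have hL : 0 < Real.log (t + Real.exp 1) := Real.log_pos (by linarith)
    positivity
  · have hx : 1 < t + Real.exp 1 := by linarith
    have hL : 0 < Real.log (t + Real.exp 1) := Real.log_pos hx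
    have hd := (((hasDerivAt_log_add (c := Real.exp 1) (by linarith)).rpow_const
      (p := γ - 1) (Or.inl hL.ne')).const_mul γ).mul (hasDerivAt_exp_log_rpow (γ := γ) ht)
    have hi := (((hasDerivAt_id t).add_const (Real.exp 1)).inv (by simp; linarith))
    refine (hd.mul hi).congr_deriv ?_
    simp only [Pi.mul_apply, Pi.inv_apply, id]
    have hq := one_add_integral_powWeight ha0 hL
    rw [quotDeriv_eq hx]
    simp only [Nat.factorial_zero, Nat.cast_zero, Nat.cast_one, Finset.range_zero,
      Finset.prod_empty, one_mul, hq]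
    have hx0 : 0 < t + Real.exp 1 := by linarith
    rw [zero_add, Real.rpow_neg_one, show -(1 - γ) = γ - 1 by ring, Real.rpow_sub_one hL.ne' (γ - 1)]
    field_simp
    ring

/-! ### Generators given by a real function -/

theorem gen_top (a : Family) (θ : ℝ) : gen a θ ⊤ = 0 := by simp [gen]

theorem gen_of_ne_top (a : Family) (θ : ℝ) {t : ℝ≥0∞} (ht : t ≠ ⊤) :
    gen a θ t = genFormula a θ t.toReal := by simp [gen, ht]

theorem gen_ofReal (a : Family) (θ : ℝ) {t : ℝ} (ht : 0 ≤ t) :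
    gen a θ (ENNReal.ofReal t) = genFormula a θ t := by
  rw [gen_of_ne_top a θ ENNReal.ofReal_ne_top, ENNReal.toReal_ofReal ht]

theorem strictAnti_gen {a : Family} {θ : ℝ} (hanti : StrictAntiOn (genFormula a θ) (Set.Ici 0))
    (hlim : Filter.Tendsto (genFormula a θ) Filter.atTop (nhds 0)) : StrictAnti (gen a θ) := by
  intro s t hst
  have hs : s ≠ ⊤ := hst.ne_top
  have hs0 : (0 : ℝ) ≤ s.toReal := ENNReal.toReal_nonneg
  rw [gen_of_ne_top a θ hs]
  by_cases ht : t = ⊤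
  · subst ht
    rw [gen_top]
    have h1 : genFormula a θ (s.toReal + 1) < genFormula a θ s.toReal :=
      hanti hs0 (add_nonneg hs0 zero_le_one) (lt_add_one _)
    refine lt_of_le_of_lt (le_of_tendsto hlim ?_) h1
    filter_upwards [Filter.eventually_ge_atTop (s.toReal + 1)] with x hx
    exact hanti.antitoneOn (add_nonneg hs0 zero_le_one : (0 : ℝ) ≤ s.toReal + 1)
      (by simp; linarith) hx
  · rw [gen_of_ne_top a θ ht]
    exact hanti hs0 ENNReal.toReal_nonneg ((ENNReal.toReal_lt_toReal hs ht).2 hst)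

theorem continuous_gen {a : Family} {θ : ℝ} (hc : ContinuousOn (genFormula a θ) (Set.Ici 0))
    (hlim : Filter.Tendsto (genFormula a θ) Filter.atTop (nhds 0)) : Continuous (gen a θ) := by
  rw [continuous_iff_continuousAt]
  intro t
  by_cases ht : t = ⊤
  · subst ht
    rw [ContinuousAt, gen_top, Metric.tendsto_nhds]
    intro ε hε
    obtain ⟨M, hM⟩ := Filter.eventually_atTop.1 ((Metric.tendsto_nhds.1 hlim) ε hε)
    filter_upwards [Ioi_mem_nhds (ENNReal.ofReal_lt_top : ENNReal.ofReal M < ⊤)] with s hs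
    by_cases hs' : s = ⊤
    · simpa [hs', gen_top] using hε
    · rw [gen_of_ne_top a θ hs']
      exact hM _ ((ENNReal.ofReal_le_iff_le_toReal hs').1 (le_of_lt hs))
  · have h1 : ContinuousAt (fun s : ℝ≥0∞ => genFormula a θ s.toReal) t :=
      (hc t.toReal ENNReal.toReal_nonneg).tendsto.comp
        (tendsto_nhdsWithin_iff.2 ⟨ENNReal.tendsto_toReal ht,
          Filter.Eventually.of_forall fun s => ENNReal.toReal_nonneg⟩)
    refine h1.congr ?_
    filter_upwards [isOpen_ne.mem_nhds ht] with s hs using (gen_of_ne_top a θ hs).symm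

theorem isGenerator_gen {a : Family} {θ : ℝ} (hc : ContinuousOn (genFormula a θ) (Set.Ici 0))
    (hanti : StrictAntiOn (genFormula a θ) (Set.Ici 0)) (h0 : genFormula a θ 0 = 1)
    (hlim : Filter.Tendsto (genFormula a θ) Filter.atTop (nhds 0)) : IsGenerator (gen a θ) := by
  have hs := strictAnti_gen hanti hlim
  have hz : gen a θ 0 = 1 := by simpa [h0] using gen_ofReal a θ le_rfl
  exact ⟨continuous_gen hc hlim, hs.antitone,
    fun t => ⟨(gen_top a θ).symm.trans_le (hs.antitone le_top),
      (hs.antitone (zero_le : 0 ≤ t)).trans_eq hz⟩,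
    hz, gen_top a θ, hs.strictAntiOn _⟩

theorem genInv_of_injective {ψ : ℝ≥0∞ → ℝ} (h : Function.Injective ψ) (t : ℝ≥0∞) :
    genInv ψ (ψ t) = t := by
  have : {s | ψ s = ψ t} = {t} := by
    ext s
    exact h.eq_iff
  rw [genInv, this, sInf_singleton]

/-- If `K = ψ₁⁻¹ ∘ ψ₂` has a completely monotone derivative, then `(ψ₁, ψ₂)` is nestable. -/
theorem mem_nestablePairs_of_hasDerivAt {a b : Family} {η θ : ℝ} {K v : ℝ → ℝ}
    (ha : gen a η ∈ cmGenerators) (hb : gen b θ ∈ cmGenerators)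
    (hinj : Function.Injective (gen a η)) (hK0 : ∀ t, 0 < t → 0 ≤ K t)
    (hK : ∀ t, 0 < t → genFormula a η (K t) = genFormula b θ t)
    (hv : ∀ t, 0 < t → HasDerivAt K (v t) t) (hcm : ∀ n, AltSign n v) :
    (gen a η, gen b θ) ∈ nestablePairs := by
  have e : ∀ t, 0 < t → nestingMap (gen a η) (gen b θ) t = K t := fun t ht => by
    rw [nestingMap, gen_ofReal b θ ht.le, ← hK t ht, ← gen_ofReal a η (hK0 t ht),
      genInv_of_injective hinj, ENNReal.toReal_ofReal (hK0 t ht)]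
  have hd : ∀ t, 0 < t → HasDerivAt (nestingMap (gen a η) (gen b θ)) (v t) t := fun t ht => by
    refine (hv t ht).congr_of_eventuallyEq ?_
    filter_upwards [Ioi_mem_nhds ht] with s hs using e s hs
  exact ⟨ha, hb, fun t ht => (hd t ht).differentiableAt.differentiableWithinAt,
    AltSign.isCM fun n => (hcm n).congr fun t ht => (hd t ht).deriv.symm⟩

/-! ### The five families -/

/-- The generator `ψ^{(a,θ)}` is `u ^ (-c)` with `c > 0` and a Bernstein function `u`, of derivative
`v`, that increases from `1` to `∞`. All five families are of this form. -/
structure IsNegPow (a : Family) (θ c : ℝ) (u v : ℝ → ℝ) : Prop where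
  pos : 0 < c
  formula : ∀ t, 0 ≤ t → genFormula a θ t = u t ^ (-c)
  map_zero : u 0 = 1
  continuousOn : ContinuousOn u (Set.Ici 0)
  strictMonoOn : StrictMonoOn u (Set.Ici 0)
  tendsto : Filter.Tendsto u Filter.atTop Filter.atTop
  hasDerivAt : ∀ t, 0 < t → HasDerivAt u (v t) t
  altSign : ∀ n, AltSign n v

namespace IsNegPow

variable {a : Family} {θ c : ℝ} {u v : ℝ → ℝ}

theorem one_le (h : IsNegPow a θ c u v) {t : ℝ} (ht : 0 ≤ t) : 1 ≤ u t :=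
  h.map_zero ▸ h.strictMonoOn.monotoneOn (Set.self_mem_Ici) ht ht

theorem strictAntiOn (h : IsNegPow a θ c u v) : StrictAntiOn (genFormula a θ) (Set.Ici 0) := by
  intro s hs t ht hst
  rw [h.formula s hs, h.formula t ht]
  exact Real.rpow_lt_rpow_of_neg (zero_lt_one.trans_le (h.one_le hs))
    (h.strictMonoOn hs ht hst) (neg_neg_of_pos h.pos)

theorem tendsto_genFormula (h : IsNegPow a θ c u v) :
    Filter.Tendsto (genFormula a θ) Filter.atTop (nhds 0) := by
  refine ((tendsto_rpow_neg_atTop h.pos).comp h.tendsto).congr' ?_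
  filter_upwards [Filter.eventually_ge_atTop 0] with t ht using (h.formula t ht).symm

theorem injective (h : IsNegPow a θ c u v) : Function.Injective (gen a θ) :=
  (strictAnti_gen h.strictAntiOn h.tendsto_genFormula).injective

theorem mem_cmGenerators (h : IsNegPow a θ c u v) : gen a θ ∈ cmGenerators := by
  refine ⟨isGenerator_gen ?_ h.strictAntiOn ?_ h.tendsto_genFormula, AltSign.isCM fun n => ?_⟩
  · refine (h.continuousOn.rpow_const fun t ht =>
      Or.inl (zero_lt_one.trans_le (h.one_le ht)).ne').congr fun t ht => h.formula t ht
  · rw [h.formula 0 le_rfl, h.map_zero, Real.one_rpow]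
  · refine ((AltSign.rpow_neg n h.pos.le).comp
      (fun t ht => zero_lt_one.trans_le (h.one_le ht.le)) h.hasDerivAt (h.altSign n)).congr ?_
    intro t ht
    rw [gen_ofReal a θ ht.le, h.formula t ht.le]

end IsNegPow

theorem hasDerivAt_one_add_rpow {θ t : ℝ} (ht : 0 < t) :
    HasDerivAt (fun s : ℝ => 1 + s ^ (1 / θ)) (1 / θ * t ^ (1 / θ - 1)) t :=
  (Real.hasDerivAt_rpow_const (Or.inl ht.ne')).const_add 1

theorem isNegPow_C {θ : ℝ} (hθ : 0 < θ) :
    IsNegPow .C θ (1 / θ) (fun t => 1 + t) (fun _ => 1) where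
  pos := by positivity
  formula t _ := by rw [genFormula, neg_div]
  map_zero := by simp
  continuousOn := by fun_prop
  strictMonoOn s _ t _ hst := by simpa using hst
  tendsto := Filter.tendsto_atTop_add_const_left _ _ Filter.tendsto_id
  hasDerivAt t _ := (hasDerivAt_id t).const_add 1
  altSign _ := AltSign.const zero_le_one

/-- The properties of `1 + t ^ (1 / θ)`, for both families built on this function. -/
theorem isNegPow_one_add_rpow {a : Family} {θ c : ℝ} (hθ : 1 ≤ θ) (hc : 0 < c)
    (h : ∀ t, 0 ≤ t → genFormula a θ t = (1 + t ^ (1 / θ)) ^ (-c)) :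
    IsNegPow a θ c (fun t => 1 + t ^ (1 / θ)) (fun t => 1 / θ * t ^ (1 / θ - 1)) := by
  have h0 : 0 < 1 / θ := by positivity
  have h1 : 1 / θ ≤ 1 := (div_le_one (by linarith)).2 hθ
  exact
    { pos := hc
      formula := h
      map_zero := by rw [Real.zero_rpow h0.ne', add_zero]
      continuousOn := continuousOn_const.add
        (continuousOn_id.rpow_const fun _ _ => Or.inr h0.le)
      strictMonoOn := fun s hs t _ hst =>
        add_lt_add_right (Real.rpow_lt_rpow hs hst h0) 1
      tendsto := Filter.tendsto_atTop_add_const_left _ _ (tendsto_rpow_atTop h0)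
      hasDerivAt := fun t ht => hasDerivAt_one_add_rpow ht
      altSign := fun n => (AltSign.rpow_of_nonpos n (by linarith)).const_mul h0.le }

theorem isNegPow_n12 {θ : ℝ} (hθ : 1 ≤ θ) :
    IsNegPow .n12 θ 1 (fun t => 1 + t ^ (1 / θ)) (fun t => 1 / θ * t ^ (1 / θ - 1)) :=
  isNegPow_one_add_rpow hθ one_pos fun t _ => by rw [genFormula, Real.rpow_neg_one]

theorem isNegPow_n14 {θ : ℝ} (hθ : 1 ≤ θ) :
    IsNegPow .n14 θ θ (fun t => 1 + t ^ (1 / θ)) (fun t => 1 / θ * t ^ (1 / θ - 1)) :=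
  isNegPow_one_add_rpow hθ (by linarith) fun _ _ => rfl

/-- The properties of `log (t + e^κ) / κ`, for both families built on this function. -/
theorem isNegPow_log {a : Family} {θ κ c : ℝ} (hκ : 0 < κ) (hc : 0 < c)
    (h : ∀ t, 0 ≤ t → genFormula a θ t = (Real.log (t + Real.exp κ) / κ) ^ (-c)) :
    IsNegPow a θ c (fun t => Real.log (t + Real.exp κ) / κ)
      (fun t => κ⁻¹ * (t + Real.exp κ) ^ (-1 : ℝ)) := by
  have he := Real.exp_pos κ
  have hpos : ∀ t, 0 ≤ t → 0 < t + Real.exp κ := fun t ht => by linarith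
  exact
    { pos := hc
      formula := h
      map_zero := by simp [hκ.ne']
      continuousOn := ((by fun_prop : ContinuousOn (fun t : ℝ => t + Real.exp κ) (Set.Ici 0)).log
        fun t ht => (hpos t ht).ne').div_const κ
      strictMonoOn := fun s hs t _ hst =>
        div_lt_div_of_pos_right (Real.log_lt_log (hpos s hs) (by linarith)) hκ
      tendsto := (Real.tendsto_log_atTop.comp
        (Filter.tendsto_atTop_add_const_right _ _ Filter.tendsto_id)).atTop_div_const hκ
      hasDerivAt := fun t ht => by
        refine ((hasDerivAt_log_add (hpos t ht.le)).div_const κ).congr_deriv ?_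
        rw [Real.rpow_neg_one]
        ring
      altSign := fun n => ((AltSign.rpow_neg n zero_le_one).comp (fun t ht => hpos t ht.le)
        (fun t _ => (hasDerivAt_id t).add_const _) (AltSign.const zero_le_one)).const_mul
          (inv_pos.2 hκ).le }

theorem isNegPow_n19 {θ : ℝ} (hθ : 0 < θ) :
    IsNegPow .n19 θ 1 (fun t => Real.log (t + Real.exp θ) / θ)
      (fun t => θ⁻¹ * (t + Real.exp θ) ^ (-1 : ℝ)) :=
  isNegPow_log hθ one_pos fun t _ => by rw [genFormula, Real.rpow_neg_one, inv_div]

theorem isNegPow_n20 {θ : ℝ} (hθ : 0 < θ) :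
    IsNegPow .n20 θ (1 / θ) (fun t => Real.log (t + Real.exp 1) / 1)
      (fun t => 1⁻¹ * (t + Real.exp 1) ^ (-1 : ℝ)) :=
  isNegPow_log one_pos (by positivity) fun t _ => by rw [genFormula, neg_div, div_one]

/-! ### Nestable pairs -/

/-- For a Clayton parent, `ψ₁⁻¹ ∘ ψ₂ = u ^ (c η) - 1`, with exponent `c η ≤ 1`. -/
theorem nestable_C {a : Family} {η θ c : ℝ} {u v : ℝ → ℝ} (h : IsNegPow a θ c u v) (hη : 0 < η)
    (hc : c * η ≤ 1) : (gen .C η, gen a θ) ∈ nestablePairs := by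
  have hp : 0 < c * η := mul_pos h.pos hη
  have hu : ∀ t, 0 < t → 0 < u t := fun t ht => zero_lt_one.trans_le (h.one_le ht.le)
  refine mem_nestablePairs_of_hasDerivAt (K := fun t => u t ^ (c * η) - 1)
    (v := fun t => v t * (c * η * u t ^ (c * η - 1)))
    (isNegPow_C hη).mem_cmGenerators h.mem_cmGenerators (isNegPow_C hη).injective
    (fun t ht => ?_) (fun t ht => ?_) (fun t ht => ?_) fun n => ?_
  · exact sub_nonneg.2 (Real.one_le_rpow (h.one_le ht.le) hp.le)
  · rw [h.formula t ht.le, genFormula, add_sub_cancel, ← Real.rpow_mul (hu t ht).le]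
    congr 1
    field_simp
  · refine (((h.hasDerivAt t ht).rpow_const (Or.inl (hu t ht).ne')).sub_const 1).congr_deriv ?_
    ring
  · exact (h.altSign n).mul (((AltSign.rpow_of_nonpos n (by linarith)).comp hu h.hasDerivAt
      (h.altSign n)).const_mul hp.le)

theorem nestable_n12 {η θ : ℝ} (hη : 1 ≤ η) (hηθ : η ≤ θ) :
    (gen .n12 η, gen .n12 θ) ∈ nestablePairs := by
  have hη0 : 0 < η := by linarith
  have hθ0 : 0 < θ := by linarith
  have hp : η / θ ≤ 1 := (div_le_one hθ0).2 hηθ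
  refine mem_nestablePairs_of_hasDerivAt (K := fun t => t ^ (η / θ))
    (v := fun t => η / θ * t ^ (η / θ - 1)) (isNegPow_n12 hη).mem_cmGenerators
    (isNegPow_n12 (hη.trans hηθ)).mem_cmGenerators (isNegPow_n12 hη).injective
    (fun t ht => by positivity) (fun t ht => ?_)
    (fun t ht => Real.hasDerivAt_rpow_const (Or.inl ht.ne'))
    fun n => (AltSign.rpow_of_nonpos n (by linarith)).const_mul (by positivity)
  rw [genFormula, genFormula, ← Real.rpow_mul ht.le]
  congr 3
  field_simp

theorem nestable_n19 {η θ : ℝ} (hη : 0 < η) (hηθ : η ≤ θ) :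
    (gen .n19 η, gen .n19 θ) ∈ nestablePairs := by
  have hθ : 0 < θ := by linarith
  have hp : η / θ ≤ 1 := (div_le_one hθ).2 hηθ
  have he := Real.exp_pos θ
  refine mem_nestablePairs_of_hasDerivAt
    (K := fun t => (t + Real.exp θ) ^ (η / θ) - Real.exp η)
    (v := fun t => η / θ * (t + Real.exp θ) ^ (η / θ - 1)) (isNegPow_n19 hη).mem_cmGenerators
    (isNegPow_n19 hθ).mem_cmGenerators (isNegPow_n19 hη).injective
    (fun t ht => ?_) (fun t ht => ?_) (fun t ht => ?_) fun n => ?_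
  · have : Real.exp η = Real.exp θ ^ (η / θ) := by
      rw [← Real.exp_mul, mul_div_cancel₀ _ hθ.ne']
    rw [this]
    exact sub_nonneg.2 (Real.rpow_le_rpow he.le (by linarith) (by positivity))
  · rw [genFormula, genFormula, sub_add_cancel, Real.log_rpow (by linarith)]
    field_simp
  · exact ((Real.hasDerivAt_rpow_const (Or.inl (by linarith))).comp_add_const t
      (Real.exp θ)).sub_const _
  · exact ((AltSign.rpow_of_nonpos n (by linarith)).comp (fun t ht => add_pos ht he)
      (fun t _ => (hasDerivAt_id t).add_const _) (AltSign.const zero_le_one)).const_mul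
        (by positivity)

theorem nestable_n20 {η θ : ℝ} (hη : 0 < η) (hηθ : η ≤ θ) :
    (gen .n20 η, gen .n20 θ) ∈ nestablePairs := by
  have hθ : 0 < θ := by linarith
  have hp : η / θ ≤ 1 := (div_le_one hθ).2 hηθ
  have hp0 : 0 < η / θ := by positivity
  have hL : ∀ t, 0 < t → 1 ≤ Real.log (t + Real.exp 1) := fun t ht => by
    rw [Real.le_log_iff_exp_le (by positivity)]
    linarith
  refine mem_nestablePairs_of_hasDerivAt
    (K := fun t => Real.exp (Real.log (t + Real.exp 1) ^ (η / θ)) - Real.exp 1)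
    (isNegPow_n20 hη).mem_cmGenerators
    (isNegPow_n20 hθ).mem_cmGenerators (isNegPow_n20 hη).injective
    (fun t ht => ?_) (fun t ht => ?_) (fun t ht => (hasDerivAt_exp_log_rpow ht).sub_const _)
    fun n => altSign_deriv_exp_log_rpow n hp0 hp
  · exact sub_nonneg.2 (Real.exp_le_exp.2 (Real.one_le_rpow (hL t ht) hp0.le))
  · rw [genFormula, genFormula, sub_add_cancel, Real.log_exp,
      ← Real.rpow_mul (zero_le_one.trans (hL t ht))]
    congr 1
    field_simp

theorem gen_mem_cmGenerators {a : Family} {θ : ℝ} (ha : a ∈ F24) (hθ : θ ∈ (paramRange a).1) :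
    gen a θ ∈ cmGenerators := by
  cases a with
  | A => simp [F24] at ha
  | C => exact (isNegPow_C hθ).mem_cmGenerators
  | n12 => exact (isNegPow_n12 hθ).mem_cmGenerators
  | n14 => exact (isNegPow_n14 hθ).mem_cmGenerators
  | n19 => exact (isNegPow_n19 hθ).mem_cmGenerators
  | n20 => exact (isNegPow_n20 hθ).mem_cmGenerators

theorem nestable_of_mem_parents24 {a b : Family} {θ η : ℝ} {r : ParamInterval}
    (hθ : θ ∈ (paramRange a).1) (hr : (b, r) ∈ parents24 a θ) (hη : η ∈ r.1) :
    (gen b η, gen a θ) ∈ nestablePairs := by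
  cases a with
  | A => simp [parents24] at hr
  | C =>
    have hθ : 0 < θ := hθ
    simp only [parents24, Finset.mem_singleton, Prod.mk.injEq] at hr
    obtain ⟨rfl, rfl⟩ := hr
    exact nestable_C (isNegPow_C hθ) hη.1 (by rw [one_div_mul_eq_div]; exact (div_le_one hθ).2 hη.2)
  | n12 =>
    simp only [parents24, Finset.mem_insert, Finset.mem_singleton, Prod.mk.injEq] at hr
    rcases hr with ⟨rfl, rfl⟩ | ⟨rfl, rfl⟩
    · exact nestable_C (isNegPow_n12 hθ) hη.1 (by rw [one_mul]; exact hη.2)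
    · exact nestable_n12 hη.1 hη.2
  | n14 =>
    have hθ1 : 1 ≤ θ := hθ
    simp only [parents24, Finset.mem_singleton, Prod.mk.injEq] at hr
    obtain ⟨rfl, rfl⟩ := hr
    exact nestable_C (isNegPow_n14 hθ) hη.1 ((le_div_iff₀' (by linarith)).1 hη.2)
  | n19 =>
    simp only [parents24, Finset.mem_insert, Finset.mem_singleton, Prod.mk.injEq] at hr
    rcases hr with ⟨rfl, rfl⟩ | ⟨rfl, rfl⟩
    · exact nestable_C (isNegPow_n19 hθ) hη.1 (by rw [one_mul]; exact hη.2)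
    · exact nestable_n19 hη.1 hη.2
  | n20 =>
    have hθ : 0 < θ := hθ
    simp only [parents24, Finset.mem_insert, Finset.mem_singleton, Prod.mk.injEq] at hr
    rcases hr with ⟨rfl, rfl⟩ | ⟨rfl, rfl⟩
    · exact nestable_C (isNegPow_n20 hθ) hη.1
        (by rw [one_div_mul_eq_div]; exact (div_le_one hθ).2 hη.2)
    · exact nestable_n20 hη.1 hη.2

/-! ### The estimated tree -/

theorem mem_children {E : Finset (ℕ × ℕ)} {v w : ℕ} : w ∈ children E v ↔ (w, v) ∈ E := by
  simp [children]

/-- The state after `k` joins: a forest on the nodes `{1, …, d + k}` with set of roots `I`, in which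
every edge leads from a node to a fork of larger number and every fork has two children. -/
structure IsForest (d k : ℕ) (s : StructState) : Prop where
  subset : s.I ⊆ Finset.Icc 1 (d + k)
  card : s.I.card + k = d
  top_mem : d + k ∈ s.I
  edge : ∀ e ∈ s.E, 1 ≤ e.1 ∧ e.1 < e.2 ∧ d + 1 ≤ e.2 ∧ e.2 ≤ d + k
  no_parent : ∀ w ∈ s.I, ∀ v, (w, v) ∉ s.E
  parent : ∀ w ∈ Finset.Icc 1 (d + k), w ∉ s.I → ∃! v, (w, v) ∈ s.E
  fork : ∀ v ∈ Finset.Icc (d + 1) (d + k), ∃ i j, i < j ∧ children s.E v = {i, j}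

theorem bestJoins_nonempty {d : ℕ} (τ : Fin d → Fin d → ℝ) {s : StructState}
    (hs : 1 < s.I.card) : (bestJoins τ s).Nonempty := by
  obtain ⟨a, b, ha, hb, hab⟩ := Finset.one_lt_card_iff.1 hs
  have hne : ((s.I ×ˢ s.I).filter (fun p => p.1 < p.2)).Nonempty := by
    rcases lt_or_gt_of_ne hab with h | h
    · exact ⟨(a, b), by simp [ha, hb, h]⟩
    · exact ⟨(b, a), by simp [ha, hb, h]⟩
  obtain ⟨p, hp, hmax⟩ := Finset.exists_max_image _ (fun p => avgTau τ s.E p.1 p.2) hne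
  exact ⟨p, Finset.mem_filter.2 ⟨hp, hmax⟩⟩

theorem IsForest.join {d k i j : ℕ} {s : StructState} (h : IsForest d k s) (hi : i ∈ s.I)
    (hj : j ∈ s.I) (hij : i < j) (τ : ℕ → ℝ) :
    IsForest d (k + 1)
      { I := (s.I ∪ {d + (k + 1)}) \ {i, j}
        E := s.E ∪ {(i, d + (k + 1)), (j, d + (k + 1))}
        tau := τ } := by
  have hI : ∀ w ∈ s.I, 1 ≤ w ∧ w ≤ d + k := fun w hw => Finset.mem_Icc.1 (h.subset hw)
  have hi' := hI i hi
  have hj' := hI j hj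
  have hnew : d + (k + 1) ∉ s.I := fun hw => by have := hI _ hw; omega
  refine ⟨fun w hw => ?_, ?_, ?_, fun e he => ?_, fun w hw v hv => ?_, fun w hw hwI => ?_,
    fun v hv => ?_⟩
  · simp only [Finset.mem_sdiff, Finset.mem_union, Finset.mem_singleton] at hw
    rw [Finset.mem_Icc]
    rcases hw.1 with hw | rfl
    · have := hI w hw; omega
    · omega
  · have hsub : ({i, j} : Finset ℕ) ⊆ s.I ∪ {d + (k + 1)} := by
      intro w hw
      simp only [Finset.mem_insert, Finset.mem_singleton] at hw
      rcases hw with rfl | rfl <;> simp [hi, hj]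
    have hc := h.card
    have h2 : ({i, j} : Finset ℕ).card = 2 := Finset.card_pair hij.ne
    have h3 : (s.I ∪ {d + (k + 1)}).card = s.I.card + 1 := by
      rw [Finset.card_union_of_disjoint (by simpa using hnew), Finset.card_singleton]
    have h4 := Finset.card_le_card hsub
    simp only [Finset.card_sdiff_of_subset hsub, h2, h3] at h4 ⊢
    omega
  · simp only [Finset.mem_sdiff, Finset.mem_union, Finset.mem_singleton, Finset.mem_insert]
    exact ⟨Or.inr trivial, by omega⟩
  · simp only [Finset.mem_union, Finset.mem_insert, Finset.mem_singleton] at he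
    rcases he with he | rfl | rfl
    · have := h.edge e he; omega
    · simp only; omega
    · simp only; omega
  · simp only [Finset.mem_sdiff, Finset.mem_union, Finset.mem_singleton, Finset.mem_insert,
      Prod.mk.injEq, not_or] at hw hv
    rcases hv with hv | ⟨rfl, _⟩ | ⟨rfl, _⟩
    · rcases hw.1 with hwI | rfl
      · exact h.no_parent w hwI v hv
      · have := h.edge _ hv; simp only at this; omega
    · exact hw.2.1 rfl
    · exact hw.2.2 rfl
  · simp only [Finset.mem_sdiff, Finset.mem_union, Finset.mem_singleton, Finset.mem_insert,
      Prod.mk.injEq, Finset.mem_Icc] at hw hwI ⊢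
    by_cases hwij : w = i ∨ w = j
    · have hwI' : w ∈ s.I := by rcases hwij with rfl | rfl <;> assumption
      refine ⟨d + (k + 1), Or.inr (by tauto), fun v hv => ?_⟩
      rcases hv with hv | hv | hv
      · exact (h.no_parent w hwI' v hv).elim
      · exact hv.2
      · exact hv.2
    · have hw1 : w ∉ s.I := fun hw' => hwI ⟨Or.inl hw', hwij⟩
      have hw2 : w ≠ d + (k + 1) := fun hw' => hwI ⟨Or.inr hw', hwij⟩
      obtain ⟨v, hv, huniq⟩ := h.parent w (Finset.mem_Icc.2 (by omega)) hw1
      refine ⟨v, Or.inl hv, fun v' hv' => ?_⟩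
      rcases hv' with hv' | hv' | hv'
      · exact huniq v' hv'
      · exact (hwij (Or.inl hv'.1)).elim
      · exact (hwij (Or.inr hv'.1)).elim
  · rw [Finset.mem_Icc] at hv
    rcases eq_or_ne v (d + (k + 1)) with rfl | hne
    · refine ⟨i, j, hij, ?_⟩
      ext w
      rw [mem_children]
      simp only [Finset.mem_union, Finset.mem_insert, Finset.mem_singleton, Prod.mk.injEq, and_true]
      constructor
      · rintro (hw | hw)
        · have := h.edge _ hw; simp only at this; omega
        · exact hw
      · exact Or.inr
    · obtain ⟨i', j', hij', hc⟩ := h.fork v (Finset.mem_Icc.2 (by omega))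
      refine ⟨i', j', hij', ?_⟩
      rw [← hc]
      ext w
      rw [mem_children, mem_children]
      simp [hne]

theorem isForest_structIter {d : ℕ} (hd : 1 ≤ d) (τ : Fin d → Fin d → ℝ)
    {tie : ℕ → Finset (ℕ × ℕ) → ℕ × ℕ} (htie : ∀ k T, T.Nonempty → tie k T ∈ T) {k : ℕ}
    (hk : k < d) : IsForest d k (structIter τ tie k) := by
  induction k with
  | zero =>
    refine ⟨by simp [structIter], by simp [structIter], by simp [structIter, hd],
      by simp [structIter], by simp [structIter], fun w hw hwI => ?_, fun v hv => ?_⟩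
    · exact (hwI (by simpa [structIter] using hw)).elim
    · rw [Finset.mem_Icc] at hv
      omega
  | succ k ih =>
    have h := ih (by omega)
    have hcard : 1 < (structIter τ tie k).I.card := by have := h.card; omega
    have hp := htie (k + 1) _ (bestJoins_nonempty τ hcard)
    simp only [bestJoins, Finset.mem_filter, Finset.mem_product] at hp
    exact h.join hp.1.1.1 hp.1.1.2 hp.1.2 _

/-- When a single root is left, the forest is a tree. -/
theorem IsForest.isHACTree {d : ℕ} (hd : 1 ≤ d) {s : StructState} (h : IsForest d (d - 1) s) :
    IsHACTree d (d - 1) (Finset.Icc 1 (2 * d - 1)) s.E := by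
  have hV : 2 * d - 1 = d + (d - 1) := by omega
  rw [hV]
  have hI : s.I = {d + (d - 1)} := by
    obtain ⟨a, ha⟩ := Finset.card_eq_one.1 (by have := h.card; omega : s.I.card = 1)
    have := h.top_mem
    rw [ha, Finset.mem_singleton] at this
    rw [ha, this]
  have hparent : ∀ w ∈ Finset.Icc 1 (d + (d - 1)), w ≠ d + (d - 1) → ∃! v, (w, v) ∈ s.E :=
    fun w hw hne => h.parent w hw (by rwa [hI, Finset.mem_singleton])
  refine ⟨rfl, fun e he => ?_, fun v => h.no_parent _ h.top_mem v, hparent, ?_, fun v hv => ?_,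
    fun v hv => ?_⟩
  · have := h.edge e he
    simp only [Finset.mem_Icc]
    omega
  · -- parents have larger numbers, so that iterating them ends in the root
    suffices H : ∀ m w, w ∈ Finset.Icc 1 (d + (d - 1)) → d + (d - 1) - w = m →
        Relation.ReflTransGen (fun w v => (w, v) ∈ s.E) w (d + (d - 1)) from
      fun w hw => H _ w hw rfl
    intro m
    induction m using Nat.strong_induction_on with
    | _ m ih =>
      intro w hw hm
      rcases eq_or_ne w (d + (d - 1)) with rfl | hne
      · exact Relation.ReflTransGen.refl
      · obtain ⟨v, hv, _⟩ := hparent w hw hne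
        have he := h.edge _ hv
        rw [Finset.mem_Icc] at hw
        simp only at he
        exact Relation.ReflTransGen.head hv
          (ih _ (by omega) v (Finset.mem_Icc.2 (by omega)) rfl)
  · refine Finset.eq_empty_of_forall_notMem fun w hw => ?_
    have := h.edge _ (mem_children.1 hw)
    rw [Finset.mem_Icc] at hv
    simp only at this
    omega
  · obtain ⟨i, j, hij, hc⟩ := h.fork v hv
    rw [hc, Finset.card_pair hij.ne]

/-! ### Admissible parents -/

theorem mem_nestInter {N₁ N₂ : NestSet} {a : Family} {r : ParamInterval} :
    (a, r) ∈ nestInter N₁ N₂ ↔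
      ∃ r₁ r₂, (a, r₁) ∈ N₁ ∧ (a, r₂) ∈ N₂ ∧ r.1 = r₁.1 ∩ r₂.1 := by
  simp only [nestInter, Finset.mem_image, Finset.mem_filter, Finset.mem_product, Prod.exists,
    Prod.mk.injEq]
  constructor
  · rintro ⟨a₁, r₁, a₂, r₂, ⟨⟨h₁, h₂⟩, h⟩, rfl, hr⟩
    obtain rfl : a₁ = a₂ := h
    exact ⟨r₁, r₂, h₁, h₂, (congrArg Subtype.val hr).symm⟩
  · rintro ⟨r₁, r₂, h₁, h₂, hr⟩
    exact ⟨a, r₁, a, r₂, ⟨⟨h₁, h₂⟩, rfl⟩, rfl, Subtype.ext hr.symm⟩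

/-- A non-empty initial segment of the parameter range of the family `a`. -/
structure IsInitial (a : Family) (r : ParamInterval) : Prop where
  subset : r.1 ⊆ (paramRange a).1
  nonempty : r.1.Nonempty
  lower : ∀ x ∈ r.1, ∀ y ∈ (paramRange a).1, y ≤ x → y ∈ r.1

/-- The property of the sets `N¹(v)` that keeps the estimation from stopping: there is a Clayton
entry, and all entries are non-empty initial segments of parameter ranges. -/
structure IsAdmissible (N : NestSet) : Prop where
  exists_C : ∃ r, (Family.C, r) ∈ N
  isInitial : ∀ a r, (a, r) ∈ N → a ∈ F24 ∧ IsInitial a r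

theorem IsInitial.inter {a : Family} {r r₁ r₂ : ParamInterval} (h₁ : IsInitial a r₁)
    (h₂ : IsInitial a r₂) (hr : r.1 = r₁.1 ∩ r₂.1) : IsInitial a r := by
  refine ⟨fun x hx => h₁.subset (hr ▸ hx : x ∈ r₁.1 ∩ r₂.1).1, ?_, fun x hx y hy hyx => ?_⟩
  · obtain ⟨x, hx⟩ := h₁.nonempty
    obtain ⟨y, hy⟩ := h₂.nonempty
    rw [hr]
    rcases le_total x y with h | h
    · exact ⟨x, hx, h₂.lower y hy x (h₁.subset hx) h⟩
    · exact ⟨y, h₁.lower x hx y (h₂.subset hy) h, hy⟩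
  · rw [hr] at hx ⊢
    exact ⟨h₁.lower x hx.1 y hy hyx, h₂.lower x hx.2 y hy hyx⟩

theorem IsAdmissible.inter {N₁ N₂ : NestSet} (h₁ : IsAdmissible N₁) (h₂ : IsAdmissible N₂) :
    IsAdmissible (nestInter N₁ N₂) := by
  refine ⟨?_, fun a r har => ?_⟩
  · obtain ⟨r₁, hr₁⟩ := h₁.exists_C
    obtain ⟨r₂, hr₂⟩ := h₂.exists_C
    exact ⟨⟨r₁.1 ∩ r₂.1, r₁.2.1.inter r₂.2.1, fun _ hx => r₁.2.2 hx.1⟩,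
      mem_nestInter.2 ⟨r₁, r₂, hr₁, hr₂, rfl⟩⟩
  · obtain ⟨r₁, r₂, hr₁, hr₂, hr⟩ := mem_nestInter.1 har
    exact ⟨(h₁.isInitial a r₁ hr₁).1,
      (h₁.isInitial a r₁ hr₁).2.inter (h₂.isInitial a r₂ hr₂).2 hr⟩

theorem IsAdmissible.ne_empty {N : NestSet} (h : IsAdmissible N) : N ≠ ∅ := by
  obtain ⟨r, hr⟩ := h.exists_C
  exact Finset.ne_empty_of_mem hr

theorem isInitial_pIoc {a : Family} (ha : (paramRange a).1 = Set.Ioi 0) {β : ℝ} (hβ : 0 < β) :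
    IsInitial a (pIoc β) :=
  ⟨fun _ hx => ha ▸ hx.1, ⟨β, hβ, le_rfl⟩, fun _ hx y hy hyx => ⟨by rw [ha] at hy; exact hy,
    hyx.trans hx.2⟩⟩

open scoped Classical in
theorem isAdmissible_fullNestSet : IsAdmissible (fullNestSet F24) := by
  refine ⟨⟨paramRange .C, Finset.mem_image.2 ⟨.C, by simp [F24], rfl⟩⟩, fun a r har => ?_⟩
  obtain ⟨b, hb, h⟩ := Finset.mem_image.1 har
  obtain ⟨rfl, rfl⟩ := Prod.mk.inj h
  refine ⟨hb, fun _ hx => hx, ⟨1, ?_⟩, fun _ _ _ hy _ => hy⟩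
  cases b <;> simp [paramRange, F24] at hb ⊢

open scoped Classical in
theorem isAdmissible_parents24 {a : Family} {θ : ℝ} (ha : a ∈ F24) (hθ : θ ∈ (paramRange a).1) :
    IsAdmissible (parents24 a θ) := by
  have hC : ∀ {β : ℝ}, 0 < β → (.C : Family) ∈ F24 ∧ IsInitial .C (pIoc β) :=
    fun hβ => ⟨by simp [F24], isInitial_pIoc rfl hβ⟩
  cases a with
  | A => simp [F24] at ha
  | C =>
    refine ⟨⟨_, Finset.mem_singleton_self _⟩, fun b r h => ?_⟩
    simp only [parents24, Finset.mem_singleton, Prod.mk.injEq] at h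
    obtain ⟨rfl, rfl⟩ := h
    exact hC hθ
  | n12 =>
    refine ⟨⟨_, Finset.mem_insert_self _ _⟩, fun b r h => ?_⟩
    simp only [parents24, Finset.mem_insert, Finset.mem_singleton, Prod.mk.injEq] at h
    rcases h with ⟨rfl, rfl⟩ | ⟨rfl, rfl⟩
    · exact hC one_pos
    · exact ⟨ha, fun _ hx => hx.1, ⟨1, le_rfl, hθ⟩, fun _ hx _ hy hyx => ⟨hy, hyx.trans hx.2⟩⟩
  | n14 =>
    have hθ1 : 1 ≤ θ := hθ
    refine ⟨⟨_, Finset.mem_singleton_self _⟩, fun b r h => ?_⟩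
    simp only [parents24, Finset.mem_singleton, Prod.mk.injEq] at h
    obtain ⟨rfl, rfl⟩ := h
    exact hC (by positivity)
  | n19 =>
    refine ⟨⟨_, Finset.mem_insert_self _ _⟩, fun b r h => ?_⟩
    simp only [parents24, Finset.mem_insert, Finset.mem_singleton, Prod.mk.injEq] at h
    rcases h with ⟨rfl, rfl⟩ | ⟨rfl, rfl⟩
    · exact hC one_pos
    · exact ⟨ha, isInitial_pIoc rfl hθ⟩
  | n20 =>
    refine ⟨⟨_, Finset.mem_insert_self _ _⟩, fun b r h => ?_⟩
    simp only [parents24, Finset.mem_insert, Finset.mem_singleton, Prod.mk.injEq] at h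
    rcases h with ⟨rfl, rfl⟩ | ⟨rfl, rfl⟩
    · exact hC hθ
    · exact ⟨ha, isInitial_pIoc rfl hθ⟩

/-! ### The estimated generators -/

theorem trim_mem {cl : ParamInterval → ℝ × ℝ} {r : ParamInterval}
    (h : IsClosing r.1 (cl r).1 (cl r).2) (θ : ℝ) : trim cl θ r ∈ r.1 :=
  r.2.1.out h.1 h.2.1 ⟨le_max_right _ _, max_le (min_le_right _ _) h.2.2.1⟩

theorem bestFits_nonempty {N : NestSet} (hN : N ≠ ∅) (cost : Family × ParamInterval → ℝ≥0) :
    (bestFits N cost).Nonempty := by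
  obtain ⟨p, hp, hmin⟩ := Finset.exists_min_image N cost (Finset.nonempty_iff_ne_empty.2 hN)
  exact ⟨p, Finset.mem_filter.2 ⟨hp, hmin⟩⟩

/-- `ψ` is a generator of a family of `F24`, and all generators described by `N` are admissible
parents of `ψ`. -/
def IsFitted (N : NestSet) (ψ : ℝ≥0∞ → ℝ) : Prop :=
  ∃ a θ, a ∈ F24 ∧ θ ∈ (paramRange a).1 ∧ ψ = gen a θ ∧
    ∀ b r, (b, r) ∈ N → ∃ r', (b, r') ∈ parents24 a θ ∧ r.1 ⊆ r'.1

theorem IsFitted.nestable {N : NestSet} {ψ : ℝ≥0∞ → ℝ} (h : IsFitted N ψ) {b : Family}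
    {r : ParamInterval} (hb : (b, r) ∈ N) {η : ℝ} (hη : η ∈ r.1) :
    (gen b η, ψ) ∈ nestablePairs := by
  obtain ⟨a, θ, _, hθ, rfl, hN⟩ := h
  obtain ⟨r', hr', hsub⟩ := hN b r hb
  exact nestable_of_mem_parents24 hθ hr' (hsub hη)

/-- One loop of the estimation does not stop at children with admissible sets, and its generator lies
in an entry of the set of each child. -/
theorem exists_estStep_eq {cl : ParamInterval → ℝ × ℝ}
    (hcl : ∀ r : ParamInterval, r.1.Nonempty → IsClosing r.1 (cl r).1 (cl r).2)
    {tie : NestSet → Family × ParamInterval} (htie : ∀ T, T.Nonempty → tie T ∈ T)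
    (stat : (ℝ≥0∞ → ℝ) → ℝ≥0) (t : ℝ) (v i j : ℕ) {s : EstState}
    (hi : IsAdmissible (s.parents i)) (hj : IsAdmissible (s.parents j)) :
    ∃ (N : NestSet) (ψ : ℝ≥0∞ → ℝ),
      estStep parents24 cl tie stat t v i j s =
        some { parents := Function.update s.parents v N, lam := Function.update s.lam v ψ } ∧
      IsAdmissible N ∧ IsFitted N ψ ∧
      ∀ w, w = i ∨ w = j → ∃ b η r, ψ = gen b η ∧ (b, r) ∈ s.parents w ∧ η ∈ r.1 := by
  have hN := hi.inter hj
  set N := nestInter (s.parents i) (s.parents j) with hNdef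
  set θ : Family × ParamInterval → ℝ := fun p => trim cl (tauInv cl p.1 t) p.2 with hθdef
  set p := tie (bestFits N (fun p => stat (gen p.1 (θ p)))) with hpdef
  have hp : (p.1, p.2) ∈ N :=
    (Finset.mem_filter.1 (htie _ (bestFits_nonempty hN.ne_empty
      (fun p => stat (gen p.1 (θ p)))))).1
  obtain ⟨hpF, hpI⟩ := hN.isInitial _ _ hp
  have hθ : θ p ∈ p.2.1 := trim_mem (hcl _ hpI.nonempty) _
  have hN' := hN.inter (isAdmissible_parents24 hpF (hpI.subset hθ))
  refine ⟨_, _, ?_, hN', ⟨p.1, θ p, hpF, hpI.subset hθ, rfl, fun b r hbr => ?_⟩, fun w hw => ?_⟩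
  · rw [estStep]
    simp only [← hNdef, if_neg hN.ne_empty]
    exact if_neg hN'.ne_empty
  · obtain ⟨r₁, r₂, _, h₂, hr⟩ := mem_nestInter.1 hbr
    exact ⟨r₂, h₂, hr ▸ Set.inter_subset_right⟩
  · obtain ⟨r₁, r₂, h₁, h₂, hr⟩ := mem_nestInter.1 hp
    rw [hr] at hθ
    rcases hw with rfl | rfl
    · exact ⟨p.1, θ p, r₁, rfl, h₁, hθ.1⟩
    · exact ⟨p.1, θ p, r₂, rfl, h₂, hθ.2⟩

/-- The state after the forks `d + 1, …, d + k` of the tree with edges `E` have been treated. -/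
structure IsEstimated (d k : ℕ) (E : Finset (ℕ × ℕ)) (s : EstState) : Prop where
  admissible : ∀ v ∈ Finset.Icc 1 (d + k), IsAdmissible (s.parents v)
  fitted : ∀ v ∈ Finset.Icc (d + 1) (d + k), IsFitted (s.parents v) (s.lam v)
  nestable : ∀ v ∈ Finset.Icc (d + 1) (d + k), ∀ w ∈ children E v, d + 1 ≤ w →
    (s.lam v, s.lam w) ∈ nestablePairs

theorem exists_estIter_eq {n d m : ℕ} (U : Fin n → Fin d → ℝ)
    (g : (k : ℕ) → (Fin k → ℝ≥0) → ℝ≥0)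
    (S : (Fin n → ℝ) → (Fin n → ℝ) → (ℝ → ℝ → ℝ) → ℝ≥0) {cl : ParamInterval → ℝ × ℝ}
    (hcl : ∀ r : ParamInterval, r.1.Nonempty → IsClosing r.1 (cl r).1 (cl r).2)
    {tie : ℕ → NestSet → Family × ParamInterval} (htie : ∀ k T, T.Nonempty → tie k T ∈ T)
    {str : StructState} (hstr : IsForest d m str) {k : ℕ} (hk : k ≤ m) :
    ∃ s, estIter U (fullNestSet F24) parents24 g S cl tie str k = some s ∧
      IsEstimated d k str.E s := by
  induction k with
  | zero =>
    refine ⟨_, rfl, fun v hv => ?_, fun v hv => ?_, fun v hv => ?_⟩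
    · rw [add_zero] at hv
      simp only [if_pos hv]
      exact isAdmissible_fullNestSet
    · rw [Finset.mem_Icc] at hv; omega
    · rw [Finset.mem_Icc] at hv; omega
  | succ k ih =>
    obtain ⟨s, hs, h⟩ := ih (by omega)
    obtain ⟨i, j, hij, hc⟩ := hstr.fork (d + (k + 1)) (Finset.mem_Icc.2 (by omega))
    have hset : {w | w ∈ children str.E (d + (k + 1))} = ({i, j} : Set ℕ) := by
      rw [hc]; ext w; simp
    have hinf : sInf ({i, j} : Set ℕ) = i := by
      rw [csInf_pair]; exact min_eq_left hij.le
    have hsup : sSup ({i, j} : Set ℕ) = j := by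
      rw [csSup_pair]; exact max_eq_right hij.le
    have hchild : ∀ v w, w ∈ children str.E v → 1 ≤ w ∧ w < v := fun v w hw => by
      have := hstr.edge _ (mem_children.1 hw)
      simp only at this
      omega
    have hi := hchild _ i (by rw [hc]; simp)
    have hj := hchild _ j (by rw [hc]; simp)
    obtain ⟨N, ψ, hstep, hN, hψ, hpar⟩ := exists_estStep_eq hcl (htie (k + 1))
      (aggStat U g S (leavesBelow d str.E i) (leavesBelow d str.E j)) (str.tau (d + (k + 1)))
      (d + (k + 1)) i j (h.admissible i (Finset.mem_Icc.2 (by omega)))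
      (h.admissible j (Finset.mem_Icc.2 (by omega)))
    refine ⟨{ parents := Function.update s.parents (d + (k + 1)) N
              lam := Function.update s.lam (d + (k + 1)) ψ },
      ?_, fun v hv => ?_, fun v hv => ?_, fun v hv w hw hdw => ?_⟩
    · rw [estIter, hs, Option.bind_some, hset, hinf, hsup, hstep]
    · rcases eq_or_ne v (d + (k + 1)) with rfl | hne
      · simpa using hN
      · rw [Finset.mem_Icc] at hv
        simpa [hne] using h.admissible v (Finset.mem_Icc.2 (by omega))
    · rcases eq_or_ne v (d + (k + 1)) with rfl | hne
      · simpa using hψ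
      · rw [Finset.mem_Icc] at hv
        simpa [hne] using h.fitted v (Finset.mem_Icc.2 (by omega))
    · have hwv := (hchild v w hw).2
      rw [Finset.mem_Icc] at hv
      have hwne : w ≠ d + (k + 1) := by omega
      rcases eq_or_ne v (d + (k + 1)) with rfl | hne
      · rw [hc, Finset.mem_insert, Finset.mem_singleton] at hw
        obtain ⟨b, η, r, rfl, hbr, hη⟩ := hpar w hw
        simpa [hwne] using (h.fitted w (Finset.mem_Icc.2 (by omega))).nestable hbr hη
      · simpa [hne, hwne] using h.nestable v (Finset.mem_Icc.2 (by omega)) w hw hdw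

end HAC

theorem mainTheorem2 {n d : ℕ} (hd : 2 ≤ d) (U : Fin n → Fin d → ℝ)
    (g : (k : ℕ) → (Fin k → NNReal) → NNReal) (hg : HAC.IsAggregation g)
    (S : (Fin n → ℝ) → (Fin n → ℝ) → (ℝ → ℝ → ℝ) → NNReal)
    (cl : HAC.ParamInterval → ℝ × ℝ)
    (hcl : ∀ r : HAC.ParamInterval, r.1.Nonempty → HAC.IsClosing r.1 (cl r).1 (cl r).2)
    (tieJoin : ℕ → Finset (ℕ × ℕ) → ℕ × ℕ)
    (htieJoin : ∀ k T, T.Nonempty → tieJoin k T ∈ T)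
    (tieFit : ℕ → HAC.NestSet → HAC.Family × HAC.ParamInterval)
    (htieFit : ∀ k T, T.Nonempty → tieFit k T ∈ T) :
    ∃ T : HAC.Triplet,
      HAC.hacEstimate U (HAC.fullNestSet HAC.F24) HAC.parents24 g S cl tieJoin tieFit = some T ∧
      HAC.IsHACTree d (d - 1) T.V T.E ∧
      (∀ v ∈ Finset.Icc (d + 1) (d + (d - 1)), T.lam v ∈ HAC.cmGenerators) ∧
      HAC.SufficientNesting d (d - 1) T := by
  have hstr := HAC.isForest_structIter (by omega) (HAC.sampleTauMatrix U) htieJoin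
    (by omega : d - 1 < d)
  obtain ⟨s, hs, h⟩ := HAC.exists_estIter_eq U g S hcl htieFit hstr le_rfl
  refine ⟨_, by rw [HAC.hacEstimate, hs, Option.map_some], hstr.isHACTree (by omega),
    fun v hv => ?_, fun v hv w hw => ?_⟩
  · obtain ⟨a, θ, ha, hθ, hψ, _⟩ := h.fitted v hv
    change s.lam v ∈ _
    rw [hψ]
    exact HAC.gen_mem_cmGenerators ha hθ
  · obtain ⟨hw, hwI⟩ := Finset.mem_inter.1 hw
    exact h.nestable v hv w hw (Finset.mem_Icc.1 hwI).1
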